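/- Let $\mathcal H\subset\mathbb R^2$ be a finite set of nonzero, mutually non-parallel vectors, let $C_\alpha$ ($\alpha\in\mathcal H$) be nonzero complex constants, and let $$L=-\Big(\frac{\partial^2}{\partial x_1^2}+\frac{\partial^2}{\partial x_2^2}\Big)+\sum_{\alpha\in\mathcal H}\frac{C_\alpha}{\langle\alpha,x\rangle^2}.$$ Let $P=\sum_{|p|\le m_0}a_p(x)\,\partial_x^p$ be a differential operator of order $m_0$ in $x=(x_1,x_2)$ whose coefficients $a_p\in\mathbb C(x_1,x_2)$ are rational functions. Assume that $[L,P]=0$, that the principal symbol $\widetilde P_0(\xi)=\sum_{|p|=m_0}a_p\,\xi^p$ does not depend on $x$, and that $P$ is non-trivial in the sense that $\widetilde P_0\notin\mathbb C[\xi_1^2+\xi_2^2]$. For $\alpha=(\alpha_1,\alpha_2)$ put $\alpha^\perp=(-\alpha_2,\alpha_1)$. Then every $\alpha_0\in\mathcal H$ satisfies $$\sum_{\beta\in\mathcal H,\ \beta\ne\alpha_0}\frac{\langle\alpha_0,\beta\rangle}{\langle\alpha_0^\perp,\beta\rangle^3}\,C_\beta=0 \qquad\text{and}\qquad \big(C_{\alpha_0}-2|\alpha_0|^2\big)\sum_{\beta\in\mathcal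 H,\ \beta\ne\alpha_0}\frac{\langle\alpha_0,\beta\rangle\,|\beta|^2}{\langle\alpha_0^\perp,\beta\rangle^5}\,C_\beta=0 .$$ -/

import Mathlib

noncomputable section

open MvPolynomial

/-- The field `ℂ(x₁, x₂)` of rational functions in two variables. -/
abbrev RatFun2 : Type := FractionRing (MvPolynomial (Fin 2) ℂ)

/-- The ring homomorphism `f ↦ f + ε ∂f/∂xᵢ` from polynomials to dual numbers over `ℂ(x₁, x₂)`. -/
def polyToDual (i : Fin 2) : MvPolynomial (Fin 2) ℂ →+* DualNumber RatFun2 where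
  toFun f := (algebraMap _ RatFun2 f, algebraMap _ RatFun2 (pderiv i f))
  map_one' := by
    refine TrivSqZeroExt.ext ?_ ?_
    · exact map_one _
    · change algebraMap _ RatFun2 (pderiv i 1) = 0
      rw [pderiv_one, map_zero]
  map_zero' := by
    refine TrivSqZeroExt.ext ?_ ?_
    · exact map_zero _
    · change algebraMap _ RatFun2 (pderiv i 0) = 0
      rw [map_zero, map_zero]
  map_add' f g := by
    refine TrivSqZeroExt.ext ?_ ?_
    · exact map_add _ f g
    · change algebraMap _ RatFun2 (pderiv i (f + g)) =
        algebraMap _ RatFun2 (pderiv i f) + algebraMap _ RatFun2 (pderiv i g)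
      rw [map_add, map_add]
  map_mul' f g := by
    refine TrivSqZeroExt.ext ?_ ?_
    · exact map_mul _ f g
    · change algebraMap _ RatFun2 (pderiv i (f * g)) =
        algebraMap _ RatFun2 f * algebraMap _ RatFun2 (pderiv i g) +
          algebraMap _ RatFun2 (pderiv i f) * algebraMap _ RatFun2 g
      rw [pderiv_mul, map_add, map_mul, map_mul, add_comm]

theorem polyToDual_isUnit (i : Fin 2) (s : nonZeroDivisors (MvPolynomial (Fin 2) ℂ)) :
    IsUnit (polyToDual i s) := by
  rw [TrivSqZeroExt.isUnit_iff_isUnit_fst]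
  have : (polyToDual i s).fst = algebraMap _ RatFun2 (s : MvPolynomial (Fin 2) ℂ) := rfl
  rw [this]
  exact IsLocalization.map_units RatFun2 s

/-- The extension of `f ↦ f + ε ∂f/∂xᵢ` to rational functions. -/
def ratToDual (i : Fin 2) : RatFun2 →+* DualNumber RatFun2 :=
  IsLocalization.lift (M := nonZeroDivisors (MvPolynomial (Fin 2) ℂ)) (polyToDual_isUnit i)

theorem ratToDual_algebraMap (i : Fin 2) (f : MvPolynomial (Fin 2) ℂ) :
    ratToDual i (algebraMap _ RatFun2 f) = polyToDual i f :=
  IsLocalization.lift_eq _ _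

theorem ratToDual_fst (i : Fin 2) (f : RatFun2) : (ratToDual i f).fst = f := by
  have h : (TrivSqZeroExt.fstHom RatFun2 RatFun2 RatFun2 : _ →+* RatFun2).comp (ratToDual i)
      = RingHom.id RatFun2 := by
    apply IsLocalization.ringHom_ext (nonZeroDivisors (MvPolynomial (Fin 2) ℂ))
    apply RingHom.ext
    intro f
    change (ratToDual i (algebraMap _ RatFun2 f)).fst = algebraMap _ RatFun2 f
    rw [ratToDual_algebraMap]
    rfl
  exact congrArg (fun φ : RatFun2 →+* RatFun2 => φ f) h

theorem ratToDual_mul_snd (i : Fin 2) (f g : RatFun2) :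
    (ratToDual i (f * g)).snd = f * (ratToDual i g).snd + g * (ratToDual i f).snd := by
  rw [map_mul, TrivSqZeroExt.snd_mul, ratToDual_fst, ratToDual_fst]
  simp [mul_comm]

/-- The partial derivative `∂/∂xᵢ` on `ℂ(x₁, x₂)`: the unique extension of the partial derivative
of polynomials to a derivation. -/
def ratPderiv (i : Fin 2) : Derivation ℂ RatFun2 RatFun2 :=
  Derivation.mk'
    { toFun := fun f => (ratToDual i f).snd
      map_add' := fun f g => by simp
      map_smul' := fun c f => by
        have h : (ratToDual i (algebraMap ℂ RatFun2 c)).snd = 0 := by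
          rw [IsScalarTower.algebraMap_apply ℂ (MvPolynomial (Fin 2) ℂ) RatFun2,
            ratToDual_algebraMap]
          change algebraMap _ RatFun2 (pderiv i (C c)) = 0
          rw [pderiv_C, map_zero]
        rw [Algebra.smul_def, ratToDual_mul_snd, h, RingHom.id_apply, Algebra.smul_def]
        simp }
    (fun f g => ratToDual_mul_snd i f g)

theorem ratPderiv_algebraMap (i : Fin 2) (f : MvPolynomial (Fin 2) ℂ) :
    ratPderiv i (algebraMap _ RatFun2 f) = algebraMap _ RatFun2 (pderiv i f) := by
  change (ratToDual i (algebraMap _ RatFun2 f)).snd = _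
  rw [ratToDual_algebraMap]
  rfl

/-- `∂/∂xᵢ` as an operator on `ℂ(x₁, x₂)`. -/
def partialOp (i : Fin 2) : Module.End ℂ RatFun2 := (ratPderiv i).toLinearMap

/-- Multiplication by `a` as an operator on `ℂ(x₁, x₂)`. -/
def mulOp (a : RatFun2) : Module.End ℂ RatFun2 := LinearMap.mulLeft ℂ a

/-- The differential operator `∑ₚ aₚ(x) ∂ₓᵖ` with full symbol `∑ₚ aₚ(x) ξᵖ`; its coefficients are
arbitrary rational functions. -/
def diffOp (P : MvPolynomial (Fin 2) RatFun2) : Module.End ℂ RatFun2 :=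
  ∑ p ∈ P.support, mulOp (P.coeff p) * (partialOp 0 ^ p 0 * partialOp 1 ^ p 1)

/-- The principal symbol of the operator with full symbol `P`: the part of top degree in `ξ`. -/
def principalSymbol (P : MvPolynomial (Fin 2) RatFun2) : MvPolynomial (Fin 2) RatFun2 :=
  homogeneousComponent P.totalDegree P

/-- The linear form `x_α = ⟨α, x⟩`, as an element of `ℂ(x₁, x₂)`. -/
def linForm (α : EuclideanSpace ℝ (Fin 2)) : RatFun2 :=
  algebraMap (MvPolynomial (Fin 2) ℂ) RatFun2 (∑ i, C (α i : ℂ) * X i)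

/-- `R(x) = ∑_{α ∈ H} c_α / ⟨α, x⟩²`. -/
def potential (H : Finset (EuclideanSpace ℝ (Fin 2))) (c : EuclideanSpace ℝ (Fin 2) → ℂ) :
    RatFun2 :=
  ∑ α ∈ H, algebraMap ℂ RatFun2 (c α) / linForm α ^ 2

/-- `L = -(∂²/∂x₁² + ∂²/∂x₂²) + R(x)`. -/
def schrodinger (H : Finset (EuclideanSpace ℝ (Fin 2))) (c : EuclideanSpace ℝ (Fin 2) → ℂ) :
    Module.End ℂ RatFun2 :=
  -(partialOp 0 ^ 2 + partialOp 1 ^ 2) + mulOp (potential H c)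

/-- `α^⊥ = (-α₂, α₁)`. -/
def perp (α : EuclideanSpace ℝ (Fin 2)) : EuclideanSpace ℝ (Fin 2) := !₂[-α 1, α 0]

end

/-! Put `t = ⟨α₀, x⟩`, `y = ⟨α₀^⊥, x⟩`, `z = t / y`. A function homogeneous of degree n is F(z) yⁿ,
so homogeneous operators act on ℂ(z). After division by |α₀|², L becomes Λ = -(∂_t² + ∂_y²) + y⁻²
V(z). Fix a generic z₀, let ζ point in the direction z = z₀ and normalise ℓ = z₀ t + y, D = z₀ ∂_t +
∂_y. A formal eigenfunction exp(λℓ) (F₀ + F₁ λ⁻¹ + …) of Λ, with F₀ = 1 and Fᵢ homogeneous of degree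
-i, amounts to 2 D Fᵢ₊₁ = Λ Fᵢ.

The commuting operator makes these equations solvable in rational functions. Let qᵢ be the degree -i
part of the (m-i)-fold commutator of P with ℓ, divided by (m-i)!, where m is the order of P. Then
[Λ, qᵢ] = 2 [D, qᵢ₊₁] (`opPiece_commutator`), q₀ is the scalar P̃₀(ζ), and q₁ has first-order part
the derivative along ∇P̃₀(ζ). Applying P minus this scalar to a truncated solution, and using that D
is injective in negative degree on functions regular at z₀, one finds q₁ 1 = 0 and that q₁ Λ Fⱼ lies
in the image of D (`exists_formal_eigenfunction`). Since ∇P̃₀(ζ) is not parallel to ζ, Euler's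
identity then integrates Λ Fⱼ itself (`exists_sliceFlow_eq`). A suitable ζ exists because a form
annihilated by the rotation field is a multiple of a power of ξ₁² + ξ₂²
(`MvPolynomial.mem_adjoin_of_rot_eq_zero`).

The obstruction comes from the pole z = 0, the line orthogonal to α₀. The equation for Fᵢ₊₁ reads
((z₀ - z)^(i+1) Fᵢ₊₁)' = ½ (z₀ - z)^i Λ Fᵢ, so the right side has no residue at 0. With V = k z⁻² +
S0 - 2 S1 z + 3 S2 z² - 4 S3 z³ + O(z⁴), the residue conditions for F₃ and F₅ are k S1 = 0 and then
k (k - 2) S3 = 0. Here k = C_{α₀} / |α₀|², while S1 and S3 are |α₀|² times the sums of C_β A / B³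
and C_β A³ / B⁵ with A = ⟨α₀, β⟩, B = ⟨α₀^⊥, β⟩. The identity A² + B² = |α₀|² |β|² gives the stated
form. -/

noncomputable section

open MvPolynomial

/-! ### Laurent recursion and its residue obstructions -/

/-- The recursion satisfied by the Laurent coefficients `f i n` of `zⁿ` in the components of
degree `-i` of a formal eigenfunction near a pole. -/
def LaurentRecursion (f : ℕ → ℤ → ℂ) (k e S0 S1 S2 S3 : ℂ) : Prop :=
  ∀ (i : ℕ) (n : ℤ), i < 5 ∧ n ≤ 3 - i →
    2 * ((n + 1) * f (i + 1) (n + 1) - e * (n + i + 1) * f (i + 1) n) =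
      e * ((k - (n + 2) * (n + 1)) * f i (n + 2) - (n + i) * (n + i + 1) * f i n + S0 * f i n
        + -2 * S1 * f i (n - 1) + 3 * S2 * f i (n - 2) + -4 * S3 * f i (n - 3))

/-- Each instance is produced with all indices as literals, so that known coefficients can be
substituted by rewriting. -/
theorem LaurentRecursion.expand {f : ℕ → ℤ → ℂ} {k e S0 S1 S2 S3 : ℂ}
    (h : LaurentRecursion f k e S0 S1 S2 S3) (i j : ℕ) (n n1 n2 m1 m2 m3 : ℤ) (x : ℂ) (y : ℂ)
    (hn : i < 5 ∧ n ≤ 3 - i := by norm_num) (hx : (n : ℂ) = x := by norm_num)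
    (hy : (i : ℂ) = y := by norm_num) (hj : i + 1 = j := by rfl) (h1 : n + 1 = n1 := by rfl)
    (h2 : n + 2 = n2 := by rfl) (h3 : n - 1 = m1 := by rfl) (h4 : n - 2 = m2 := by rfl)
    (h5 : n - 3 = m3 := by rfl) :
    2 * ((x + 1) * f j n1 - e * (x + y + 1) * f j n) =
      e * ((k - (x + 2) * (x + 1)) * f i n2 - (x + y) * (x + y + 1) * f i n + S0 * f i n
        + -2 * S1 * f i m1 + 3 * S2 * f i m2 + -4 * S3 * f i m3) := by
  subst hj h1 h2 h3 h4 h5 hx hy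
  exact h i n hn

/-- This is the vanishing of the residue at 0 of the source term for F₃. In the row n = -1 the
coefficient of `f (i + 1) 0` is zero, so that row is a compatibility condition rather than a
definition. -/
theorem LaurentRecursion.first_obstruction {f : ℕ → ℤ → ℂ} {k e S0 S1 S2 S3 : ℂ}
    (h00 : f 0 0 = 1) (h0 : ∀ n : ℤ, n ≠ 0 → f 0 n = 0)
    (hs : ∀ (i : ℕ) (n : ℤ), i ≤ 5 ∧ n < -i → f i n = 0)
    (hrec : LaurentRecursion f k e S0 S1 S2 S3) :
    -(k * e ^ 3 * S1) = 0 := by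
  have h0m2 := hrec.expand 0 1 (-2) (-1) 0 (-3) (-4) (-5) (-2) 0
  have h0p0 := hrec.expand 0 1 0 1 2 (-1) (-2) (-3) 0 0
  have h0p1 := hrec.expand 0 1 1 2 3 0 (-1) (-2) 1 0
  have h1m3 := hrec.expand 1 2 (-3) (-2) (-1) (-4) (-5) (-6) (-3) 1
  have h1m2 := hrec.expand 1 2 (-2) (-1) 0 (-3) (-4) (-5) (-2) 1
  have h1p0 := hrec.expand 1 2 0 1 2 (-1) (-2) (-3) 0 1
  have h2m3 := hrec.expand 2 3 (-3) (-2) (-1) (-4) (-5) (-6) (-3) 2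
  have h2m2 := hrec.expand 2 3 (-2) (-1) 0 (-3) (-4) (-5) (-2) 2
  have h2m1 := hrec.expand 2 3 (-1) 0 1 (-2) (-3) (-4) (-1) 2
  simp only [h0 (-5) (by norm_num), h0 (-4) (by norm_num), h0 (-3) (by norm_num), h0 (-2) (by
    norm_num), h0 (-1) (by norm_num), h0 1 (by norm_num), h0 2 (by norm_num), h0 3 (by
    norm_num), hs 1 (-6) (by norm_num), hs 1 (-5) (by norm_num), hs 1 (-4) (by norm_num), hs 1
    (-3) (by norm_num), hs 1 (-2) (by norm_num), hs 2 (-6) (by norm_num), hs 2 (-5) (by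
    norm_num), hs 2 (-4) (by norm_num), hs 2 (-3) (by norm_num), h00]
    at h0m2 h0p0 h0p1 h1m3 h1m2 h1p0 h2m3 h2m2 h2m1
  -- The weights e², -2e, 1 of the rows i = 2 are the coefficients of (1 - e z)², so the combined
  -- left side is the residue of an exact derivative. The remaining weights eliminate the
  -- coefficients of F₁ and F₂.
  linear_combination (-(1/4) * k * e^3 * S0 + (1/4) * k * e^2 * S1 + (1/2) * e^3 * S0 + (1/2) *
    e^2 * S1) * h0m2 + ((1/4) * k^2 * e^3 - (1/2) * k * e^3) * h0p0 + ((1/8) * k^2 * e^2 - (1/4)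
    * k * e^2) * h0p1 + ((1/2) * e^2 * S0 + (1/2) * e * S1) * h1m3 + (-(1/2) * k * e^3 + e^3 -
    (1/2) * e * S0 + e) * h1m2 + ((1/2) * k * e) * h1p0 + (e^2) * h2m3 + (-2 * e) * h2m2 + (1) *
    h2m1

/-- The same residue condition two steps later, for F₅. The row i = 4, n = -1 is at the edge n ≤ 3 -
i of the range in which S0, …, S3 determine the potential. -/
theorem LaurentRecursion.second_obstruction {f : ℕ → ℤ → ℂ} {k e S0 S1 S2 S3 : ℂ}
    (h00 : f 0 0 = 1) (h0 : ∀ n : ℤ, n ≠ 0 → f 0 n = 0)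
    (hs : ∀ (i : ℕ) (n : ℤ), i ≤ 5 ∧ n < -i → f i n = 0)
    (hrec : LaurentRecursion f k e S0 S1 S2 S3) (hS1 : S1 = 0) :
    3 / 2 * k * (k - 2) * e ^ 5 * S3 = 0 := by
  have h0m2 := hrec.expand 0 1 (-2) (-1) 0 (-3) (-4) (-5) (-2) 0
  have h0p0 := hrec.expand 0 1 0 1 2 (-1) (-2) (-3) 0 0
  have h0p1 := hrec.expand 0 1 1 2 3 0 (-1) (-2) 1 0
  have h0p2 := hrec.expand 0 1 2 3 4 1 0 (-1) 2 0
  have h0p3 := hrec.expand 0 1 3 4 5 2 1 0 3 0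
  have h1m3 := hrec.expand 1 2 (-3) (-2) (-1) (-4) (-5) (-6) (-3) 1
  have h1m2 := hrec.expand 1 2 (-2) (-1) 0 (-3) (-4) (-5) (-2) 1
  have h1p0 := hrec.expand 1 2 0 1 2 (-1) (-2) (-3) 0 1
  have h1p1 := hrec.expand 1 2 1 2 3 0 (-1) (-2) 1 1
  have h1p2 := hrec.expand 1 2 2 3 4 1 0 (-1) 2 1
  have h2m4 := hrec.expand 2 3 (-4) (-3) (-2) (-5) (-6) (-7) (-4) 2
  have h2m3 := hrec.expand 2 3 (-3) (-2) (-1) (-4) (-5) (-6) (-3) 2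
  have h2m2 := hrec.expand 2 3 (-2) (-1) 0 (-3) (-4) (-5) (-2) 2
  have h2p0 := hrec.expand 2 3 0 1 2 (-1) (-2) (-3) 0 2
  have h2p1 := hrec.expand 2 3 1 2 3 0 (-1) (-2) 1 2
  have h3m5 := hrec.expand 3 4 (-5) (-4) (-3) (-6) (-7) (-8) (-5) 3
  have h3m4 := hrec.expand 3 4 (-4) (-3) (-2) (-5) (-6) (-7) (-4) 3
  have h3m3 := hrec.expand 3 4 (-3) (-2) (-1) (-4) (-5) (-6) (-3) 3
  have h3m2 := hrec.expand 3 4 (-2) (-1) 0 (-3) (-4) (-5) (-2) 3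
  have h3p0 := hrec.expand 3 4 0 1 2 (-1) (-2) (-3) 0 3
  have h4m5 := hrec.expand 4 5 (-5) (-4) (-3) (-6) (-7) (-8) (-5) 4
  have h4m4 := hrec.expand 4 5 (-4) (-3) (-2) (-5) (-6) (-7) (-4) 4
  have h4m3 := hrec.expand 4 5 (-3) (-2) (-1) (-4) (-5) (-6) (-3) 4
  have h4m2 := hrec.expand 4 5 (-2) (-1) 0 (-3) (-4) (-5) (-2) 4
  have h4m1 := hrec.expand 4 5 (-1) 0 1 (-2) (-3) (-4) (-1) 4
  simp only [h0 (-5) (by norm_num), h0 (-4) (by norm_num), h0 (-3) (by norm_num), h0 (-2) (by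
    norm_num), h0 (-1) (by norm_num), h0 1 (by norm_num), h0 2 (by norm_num), h0 3 (by
    norm_num), h0 4 (by norm_num), h0 5 (by norm_num), hs 1 (-6) (by norm_num), hs 1 (-5) (by
    norm_num), hs 1 (-4) (by norm_num), hs 1 (-3) (by norm_num), hs 1 (-2) (by norm_num), hs 2
    (-7) (by norm_num), hs 2 (-6) (by norm_num), hs 2 (-5) (by norm_num), hs 2 (-4) (by
    norm_num), hs 2 (-3) (by norm_num), hs 3 (-8) (by norm_num), hs 3 (-7) (by norm_num), hs 3
    (-6) (by norm_num), hs 3 (-5) (by norm_num), hs 3 (-4) (by norm_num), hs 4 (-8) (by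
    norm_num), hs 4 (-7) (by norm_num), hs 4 (-6) (by norm_num), hs 4 (-5) (by norm_num), h00,
    hS1]
    at h0m2 h0p0 h0p1 h0p2 h0p3 h1m3 h1m2 h1p0 h1p1 h1p2 h2m4 h2m3 h2m2 h2p0 h2p1 h3m5 h3m4 h3m3 h3m2 h3p0 h4m5 h4m4 h4m3 h4m2 h4m1
  -- The rows i = 4 enter with the coefficients of (1 - e z)⁴, the integrating factor up to scale.
  -- The other rows eliminate F₁, …, F₄.
  linear_combination (-(11/32) * k^3 * e^7 * S0 - (3/32) * k^3 * e^5 * S2 + (1/96) * k^3 * e^4 *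
    S3 + (23/8) * k^2 * e^7 * S0 - (1/8) * k^2 * e^5 * S0^2 + k^2 * e^5 * S0 + (9/8) * k^2 * e^5
    * S2 - (5/24) * k^2 * e^4 * S3 - (65/8) * k * e^7 * S0 + (5/8) * k * e^5 * S0^2 - 5 * k *
    e^5 * S0 - (33/8) * k * e^5 * S2 - (3/8) * k * e^4 * S3 + (15/2) * e^7 * S0 - (3/4) * e^5 *
    S0^2 + 6 * e^5 * S0 + (9/2) * e^5 * S2 + (3/2) * e^4 * S3) * h0m2 + ((11/32) * k^4 * e^7 -
    (23/8) * k^3 * e^7 + (1/8) * k^3 * e^5 * S0 - k^3 * e^5 + (65/8) * k^2 * e^7 - (5/8) * k^2 *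
    e^5 * S0 + 5 * k^2 * e^5 - (15/2) * k * e^7 + (3/4) * k * e^5 * S0 - 6 * k * e^5) * h0p0 +
    ((11/64) * k^4 * e^6 - (23/16) * k^3 * e^6 + (1/48) * k^3 * e^4 * S0 - (1/4) * k^3 * e^4 +
    (65/16) * k^2 * e^6 - (5/48) * k^2 * e^4 * S0 + (5/4) * k^2 * e^4 - (15/4) * k * e^6 + (1/8)
    * k * e^4 * S0 - (3/2) * k * e^4) * h0p1 + ((1/32) * k^4 * e^5 - (3/8) * k^3 * e^5 + (11/8)
    * k^2 * e^5 - (3/2) * k * e^5) * h0p2 + ((1/384) * k^4 * e^4 - (5/96) * k^3 * e^4 + (9/32) *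
    k^2 * e^4 - (3/8) * k * e^4) * h0p3 + ((11/16) * k^2 * e^6 * S0 - (5/16) * k^2 * e^4 * S2 +
    (1/16) * k^2 * e^3 * S3 - (35/8) * k * e^6 * S0 + (1/4) * k * e^4 * S0^2 - 2 * k * e^4 * S0
    - (3/8) * k * e^4 * S2 - (1/8) * k * e^3 * S3 + (15/2) * e^6 * S0 - (3/4) * e^4 * S0^2 + 6 *
    e^4 * S0 + (9/2) * e^4 * S2 + (3/2) * e^3 * S3) * h1m3 + (-(11/16) * k^3 * e^7 + (23/4) *
    k^2 * e^7 - (3/4) * k^2 * e^5 * S0 + 3 * k^2 * e^5 - (1/16) * k^2 * e^3 * S2 - (65/4) * k *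
    e^7 + (15/4) * k * e^5 * S0 - 15 * k * e^5 - (1/16) * k * e^3 * S0^2 + (7/8) * k * e^3 * S0
    + (1/2) * k * e^3 * S2 - (3/2) * k * e^3 + 15 * e^7 - (9/2) * e^5 * S0 + 18 * e^5 + (1/8) *
    e^3 * S0^2 - (7/4) * e^3 * S0 - (3/4) * e^3 * S2 + 3 * e^3) * h1m2 + ((1/2) * k^3 * e^5 -
    (5/2) * k^2 * e^5 + (1/16) * k^2 * e^3 * S0 - (3/4) * k^2 * e^3 + 3 * k * e^5 - (1/8) * k *
    e^3 * S0 + (3/2) * k * e^3) * h1p0 + ((1/6) * k^3 * e^4 - (5/6) * k^2 * e^4 + k * e^4) *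
    h1p1 + ((1/48) * k^3 * e^3 - (1/6) * k^2 * e^3 + (1/4) * k * e^3) * h1p2 + (-(3/4) * k * e^5
    * S0 - (1/4) * k * e^3 * S2 + (1/4) * k * e^2 * S3 + 3 * e^5 * S0 - (1/4) * e^3 * S0^2 + 2 *
    e^3 * S0 + 3 * e^3 * S2 + e^2 * S3) * h2m4 + ((11/8) * k^2 * e^6 - (35/4) * k * e^6 + (3/2)
    * k * e^4 * S0 - 6 * k * e^4 - (1/4) * k * e^2 * S2 + 15 * e^6 - (9/2) * e^4 * S0 + 18 * e^4
    + (1/8) * e^2 * S0^2 - (7/4) * e^2 * S0 - (3/4) * e^2 * S2 + 3 * e^2) * h2m3 + (-2 * k^2 *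
    e^5 + 10 * k * e^5 - (3/4) * k * e^3 * S0 + 6 * k * e^3 - 12 * e^5 + (3/2) * e^3 * S0 - 12 *
    e^3) * h2m2 + ((1/2) * k^2 * e^3 - k * e^3) * h2p0 + ((1/8) * k^2 * e^2 - (1/4) * k * e^2) *
    h2p1 + ((1/2) * e^4 * S0 + (3/2) * e^2 * S2 + (1/2) * e * S3) * h3m5 + (-(3/2) * k * e^5 + 6
    * e^5 - (3/2) * e^3 * S0 + 6 * e^3 - (1/2) * e * S2) * h3m4 + (4 * k * e^4 - 12 * e^4 +
    (3/2) * e^2 * S0 - 12 * e^2) * h3m3 + (-3 * k * e^3 + 6 * e^3 - (1/2) * e * S0 + 6 * e) *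
    h3m2 + ((1/2) * k * e) * h3p0 + (e^4) * h4m5 + (-4 * e^3) * h4m4 + (6 * e^2) * h4m3 + (-4 *
    e) * h4m2 + (1) * h4m1

/-! ### Formal eigenfunctions from a commuting operator -/

/-- Abstract construction of formal eigenfunctions. `d` plays the role of a directional derivative,
`Λ` that of a Schrödinger operator, and `q a` are the homogeneous pieces of an operator commuting
with it; the index in `ℤ` is the degree of homogeneity of the argument. -/
theorem exists_formal_eigenfunction {K : Type*} [AddCommGroup K] [Module ℂ K]
    (O : Submodule ℂ K) (u : K) (hu : u ∈ O) (d Λ : ℤ → K →ₗ[ℂ] K) (q : ℕ → ℤ → K →ₗ[ℂ] K) (c : ℂ)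
    (hq0 : ∀ n F, q 0 n F = c • F)
    (hcomm : ∀ (a : ℕ) (n : ℤ) F, Λ (n - a) (q a n F) - q a (n - 2) (Λ n F) =
      (2 : ℂ) • (d (n - a - 1) (q (a + 1) n F) - q (a + 1) (n - 1) (d n F)))
    (hker : ∀ n : ℤ, n < 0 → ∀ F ∈ O, d n F = 0 → F = 0)
    (hqO : ∀ a n, ∀ F ∈ O, q a n F ∈ O) (hΛO : ∀ n, ∀ F ∈ O, Λ n F ∈ O) (hdu : d 0 u = 0)
    (hsolve : q 1 0 u = 0 → ∀ n : ℤ, n ≤ -2 → ∀ F ∈ O, ∀ G ∈ O, q 1 n F = d n G →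
      ∃ F' ∈ O, d (n + 1) F' = F) (j : ℕ) :
    ∃ F : ℕ → K, F 0 = u ∧ (∀ i, F i ∈ O) ∧
      ∀ i < j, (2 : ℂ) • d (-((i + 1 : ℕ) : ℤ)) (F (i + 1)) = Λ (-(i : ℤ)) (F i) := by
  induction j with
  | zero => exact ⟨fun _ => u, rfl, fun _ => hu, by simp⟩
  | succ j ih =>
    obtain ⟨F, hF0, hFO, hF⟩ := ih
    -- `q'` represents the commuting operator minus its scalar leading part `q 0`.
    let q' : ℕ → ℤ → K →ₗ[ℂ] K := fun a n => if a = 0 then 0 else q a n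
    have hq'0 : ∀ n, q' 0 n = 0 := fun n => by simp [q']
    have hq' : ∀ a n, q' (a + 1) n = q (a + 1) n := fun a n => by simp [q']
    have hq'O : ∀ a n, ∀ F ∈ O, q' a n F ∈ O := by
      intro a n F hF
      by_cases ha : a = 0
      · subst ha; rw [hq'0]; simp
      · simp only [q', if_neg ha]; exact hqO a n F hF
    -- The degree -i part of that difference applied to F₀ + … + Fⱼ. For b > i the truncated
    -- subtraction gives `q' 0 = 0`, so such terms vanish as they should.
    let χ : ℕ → K := fun i => ∑ b ∈ Finset.range (j + 1), q' (i - b) (-(b : ℤ)) (F b)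
    have hχO : ∀ i, χ i ∈ O := fun i => Submodule.sum_mem _ fun b _ => hq'O _ _ _ (hFO b)
    -- Dropping `q 0` does not disturb `hcomm`, because a scalar commutes with everything.
    have key : ∀ i b : ℕ, (2 : ℂ) • d (-((i + 1 : ℕ) : ℤ)) (q' (i + 1 - b) (-(b : ℤ)) (F b))
        - Λ (-(i : ℤ)) (q' (i - b) (-(b : ℤ)) (F b)) =
        (2 : ℂ) • q' (i + 1 - b) (-(b : ℤ) - 1) (d (-(b : ℤ)) (F b))
          - q' (i - b) (-(b : ℤ) - 2) (Λ (-(b : ℤ)) (F b)) := by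
      intro i b
      rcases le_or_gt b i with hb | hb
      · obtain ⟨a, rfl⟩ := Nat.exists_eq_add_of_le hb
        have h := hcomm a (-(b : ℤ)) (F b)
        have e1 : (-(b : ℤ)) - a = -((b + a : ℕ) : ℤ) := by push_cast; ring
        have e2 : -((b + a : ℕ) : ℤ) - 1 = -((b + a + 1 : ℕ) : ℤ) := by push_cast; ring
        rw [e1, e2] at h
        rw [show b + a + 1 - b = a + 1 by omega, show b + a - b = a by omega, hq']
        rw [hq']
        rcases a with _ | a
        · rw [hq0, hq0, map_smul, Nat.add_zero, sub_self] at h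
          simp only [hq'0, LinearMap.zero_apply, map_zero, sub_zero]
          rw [smul_sub] at h
          exact (sub_eq_zero.mp h.symm)
        · rw [hq', hq']
          rw [smul_sub] at h
          rw [sub_eq_sub_iff_sub_eq_sub]
          exact h.symm
      · rw [show i + 1 - b = 0 by omega, show i - b = 0 by omega]
        simp [hq'0]
    -- The eigenfunction equations make the sum telescope. The first term dies since `d 0 u = 0`;
    -- only the boundary term with Λ Fⱼ, for which no equation is available yet, survives.
    have hrec : ∀ i : ℕ, (2 : ℂ) • d (-((i + 1 : ℕ) : ℤ)) (χ (i + 1)) - Λ (-(i : ℤ)) (χ i) =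
        - q' (i - j) (-(j : ℤ) - 2) (Λ (-(j : ℤ)) (F j)) := by
      intro i
      simp only [χ, map_sum, Finset.smul_sum]
      rw [← Finset.sum_sub_distrib, Finset.sum_congr rfl fun b _ => key i b,
        Finset.sum_sub_distrib, Finset.sum_range_succ', Finset.sum_range_succ (fun b =>
          q' (i - b) (-(b : ℤ) - 2) (Λ (-(b : ℤ)) (F b)))]
      have : ∀ b ∈ Finset.range j, (2 : ℂ) • q' (i + 1 - (b + 1)) (-((b + 1 : ℕ) : ℤ) - 1)
          (d (-((b + 1 : ℕ) : ℤ)) (F (b + 1))) =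
          q' (i - b) (-(b : ℤ) - 2) (Λ (-(b : ℤ)) (F b)) := by
        intro b hb
        rw [← map_smul, hF b (Finset.mem_range.mp hb), Nat.add_sub_add_right,
          show (-((b + 1 : ℕ) : ℤ) - 1) = -(b : ℤ) - 2 by push_cast; ring]
      rw [Finset.sum_congr rfl this]
      simp [hF0, hdu]
    -- For i ≤ j the boundary term carries `q' 0 = 0`, so injectivity of `d` in negative degrees
    -- propagates the vanishing upwards.
    have hvan : ∀ i ≤ j + 1, χ i = 0 := by
      intro i
      induction i with
      | zero => intro _; simp [χ, hq'0]
      | succ i ih =>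
        intro hi
        have h := hrec i
        rw [ih (by omega), show i - j = 0 by omega, hq'0] at h
        simp only [map_zero, sub_zero, LinearMap.zero_apply, neg_zero, smul_eq_zero,
          OfNat.ofNat_ne_zero, false_or] at h
        exact hker _ (by push_cast; omega) _ (hχO _) h
    have hB : q 1 0 u = 0 := by
      have h := hvan 1 (by omega)
      simp only [χ] at h
      rw [Finset.sum_range_succ'] at h
      simpa [hq'0, hF0, q'] using h
    -- The first nonzero boundary term: 2 d χⱼ₊₂ = -q₁ (Λ Fⱼ). Hence q₁ (Λ Fⱼ) is in the image of
    -- `d`, and `hsolve` applies.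
    have hlast := hrec (j + 1)
    rw [hvan (j + 1) le_rfl, show j + 1 - j = 0 + 1 by omega, hq', map_zero, sub_zero] at hlast
    obtain ⟨F', hF'O, hF'⟩ := hsolve hB (-(j : ℤ) - 2) (by omega) _ (hΛO (-(j : ℤ)) _ (hFO j))
      (-(2 : ℂ) • χ (j + 2)) (O.smul_mem _ (hχO _)) (by
        rw [map_smul, neg_smul, eq_neg_iff_add_eq_zero, add_comm, ← eq_neg_iff_add_eq_zero]
        convert hlast using 4
        push_cast; ring)
    refine ⟨fun i => if i = j + 1 then (2⁻¹ : ℂ) • F' else F i, by simp [hF0], ?_, ?_⟩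
    · intro i
      dsimp only
      split_ifs
      · exact O.smul_mem _ hF'O
      · exact hFO i
    · intro i hi
      dsimp only
      rcases Nat.lt_succ_iff_lt_or_eq.mp hi with h | rfl
      · rw [if_neg (by omega), if_neg (by omega)]
        exact hF i h
      · rw [if_pos rfl, if_neg (by omega), map_smul, smul_smul]
        rw [show (-((i + 1 : ℕ) : ℤ)) = -(i : ℤ) - 2 + 1 by push_cast; ring, hF']
        norm_num

/-! ### Rotation-invariant binary forms -/

/-- For the coefficients `a i` of X₀ⁱ X₁^(m-i), annihilation by the rotation field is a two-step
recursion, so `a 0` and `a 1` determine the form. -/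
theorem coeff_mem_of_rot_eq_zero_aux {m : ℕ} (a : ℕ → ℂ) (ha : a 1 = 0)
    (h : ∀ i, 1 ≤ i → i < m → (i + 1 : ℂ) * a (i + 1) = (m - i + 1 : ℂ) * a (i - 1))
    (h0 : a 0 = 0) : ∀ i ≤ m, a i = 0 := by
  intro i
  induction i using Nat.strong_induction_on with
  | _ i ih =>
    intro hi
    rcases i with _ | _ | i
    · exact h0
    · exact ha
    · have := h (i + 1) (by omega) (by omega)
      rw [show i + 1 - 1 = i by omega, ih i (by omega) (by omega), mul_zero] at this
      have h2 : ((i + 1 : ℕ) + 1 : ℂ) ≠ 0 := Nat.cast_add_one_ne_zero _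
      exact (mul_eq_zero.mp this).resolve_left h2

theorem MvPolynomial.coeff_X_mul_pderiv {R : Type*} [CommRing R] (p : MvPolynomial (Fin 2) R)
    (i j : ℕ) :
    coeff (Finsupp.single 0 i + Finsupp.single 1 j) (X 1 * pderiv 0 p - X 0 * pderiv 1 p) =
      (if j = 0 then 0 else
        coeff (Finsupp.single 0 (i + 1) + Finsupp.single 1 (j - 1)) p * (i + 1)) -
      (if i = 0 then 0 else
        coeff (Finsupp.single 0 (i - 1) + Finsupp.single 1 (j + 1)) p * (j + 1)) := by
  rw [coeff_sub, coeff_X_mul', coeff_X_mul', coeff_pderiv, coeff_pderiv]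
  have e1 : j ≠ 0 → (Finsupp.single (0 : Fin 2) i + Finsupp.single 1 j) - Finsupp.single 1 1 +
      Finsupp.single 0 1 = Finsupp.single 0 (i + 1) + Finsupp.single 1 (j - 1) := by
    intro hj; ext x; fin_cases x <;> simp
  have e2 : i ≠ 0 → (Finsupp.single (0 : Fin 2) i + Finsupp.single 1 j) - Finsupp.single 0 1 +
      Finsupp.single 1 1 = Finsupp.single 0 (i - 1) + Finsupp.single 1 (j + 1) := by
    intro hj; ext x; fin_cases x <;> simp
  congr 1
  · by_cases hj : j = 0
    · simp [hj]
    · rw [if_pos (by simp [hj]), if_neg hj, e1 hj]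
      simp
  · by_cases hj : i = 0
    · simp [hj]
    · rw [if_pos (by simp [hj]), if_neg hj, e2 hj]
      simp

theorem MvPolynomial.finTwo_eq (x : Fin 2 →₀ ℕ) :
    x = Finsupp.single 0 (x 0) + Finsupp.single 1 (x 1) := by
  ext i; fin_cases i <;> simp

/-- A homogeneous rotation-invariant polynomial whose coefficient at `X₁ᵐ` vanishes is zero. -/
theorem MvPolynomial.eq_zero_of_rot_eq_zero {p : MvPolynomial (Fin 2) ℂ} {m : ℕ}
    (hp : p.IsHomogeneous m) (hrot : X 1 * pderiv 0 p - X 0 * pderiv 1 p = 0)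
    (h0 : coeff (Finsupp.single 1 m) p = 0) : p = 0 := by
  have hc := fun i j => coeff_X_mul_pderiv p i j
  simp only [hrot, coeff_zero] at hc
  have key := coeff_mem_of_rot_eq_zero_aux (m := m)
    (fun i => coeff (Finsupp.single 0 i + Finsupp.single 1 (m - i)) p) ?_ ?_ ?_
  · ext x
    rw [coeff_zero]
    by_cases hx : x 0 + x 1 = m
    · rw [finTwo_eq x, show x 1 = m - x 0 by omega]
      exact key (x 0) (by omega)
    · refine hp.coeff_eq_zero ?_
      rw [Finsupp.degree_eq_sum]
      simpa [Fin.sum_univ_two] using hx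
  · rcases m with _ | m
    · refine hp.coeff_eq_zero ?_
      simp
    · simpa using (hc 0 (m + 1)).symm
  · intro i hi him
    have := hc i (m - i)
    rw [if_neg (by omega), if_neg (by omega), show m - i + 1 = m - (i - 1) by omega,
      show m - i - 1 = m - (i + 1) by omega] at this
    have hcast : ((m - i : ℕ) : ℂ) = m - i := by
      rw [Nat.cast_sub him.le]
    rw [hcast] at this
    linear_combination -this
  · simpa using h0

/-- In even degree, subtracting a multiple of (X₀² + X₁²)ⁿ removes the coefficient at X₁ᵐ and leaves
zero. In odd degree the recursion, started from the other end X₀²ⁿ X₁, reaches X₁ᵐ itself, so the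
form vanishes. -/
theorem MvPolynomial.mem_adjoin_of_rot_eq_zero {p : MvPolynomial (Fin 2) ℂ} {m : ℕ}
    (hp : p.IsHomogeneous m) (hrot : X 1 * pderiv 0 p - X 0 * pderiv 1 p = 0) :
    p ∈ Algebra.adjoin ℂ {(X 0 ^ 2 + X 1 ^ 2 : MvPolynomial (Fin 2) ℂ)} := by
  have hr : (X 0 ^ 2 + X 1 ^ 2 : MvPolynomial (Fin 2) ℂ).IsHomogeneous 2 :=
    ((isHomogeneous_X _ _).pow 2).add ((isHomogeneous_X _ _).pow 2)
  rcases Nat.even_or_odd' m with ⟨n, hn | hn⟩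
  · obtain ⟨c, hc⟩ : ∃ c, coeff (Finsupp.single 1 m) p = c := ⟨_, rfl⟩
    have h : p - C c * (X 0 ^ 2 + X 1 ^ 2) ^ n = 0 := by
      refine eq_zero_of_rot_eq_zero (m := m) (hp.sub ?_) ?_ ?_
      · have := (isHomogeneous_C (Fin 2) c).mul (hr.pow n)
        rwa [zero_add, ← hn] at this
      · have e : X 1 * pderiv 0 (C c * (X 0 ^ 2 + X 1 ^ 2 : MvPolynomial (Fin 2) ℂ) ^ n) =
            X 0 * pderiv 1 (C c * (X 0 ^ 2 + X 1 ^ 2 : MvPolynomial (Fin 2) ℂ) ^ n) := by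
          simp only [pderiv_C_mul, pderiv_pow, map_add, pderiv_X_self,
            pderiv_X_of_ne (show (1 : Fin 2) ≠ 0 by decide),
            pderiv_X_of_ne (show (0 : Fin 2) ≠ 1 by decide)]
          ring
        rw [map_sub, map_sub]
        linear_combination hrot - e
      · have e : coeff (Finsupp.single 1 m)
            ((X 0 ^ 2 + X 1 ^ 2 : MvPolynomial (Fin 2) ℂ) ^ n) = 1 := by
          have h1 : (X 0 ^ 2 + X 1 ^ 2 : MvPolynomial (Fin 2) ℂ) ^ n =
              X 1 ^ (2 * n) + X 0 * (X 0 * ∑ k ∈ Finset.range n,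
                (X 0 ^ 2 + X 1 ^ 2) ^ k * (X 1 ^ 2) ^ (n - 1 - k)) := by
            have := (Commute.all (X 0 ^ 2 + X 1 ^ 2 : MvPolynomial (Fin 2) ℂ)
              (X 1 ^ 2)).mul_geom_sum₂ n
            linear_combination -this
          rw [h1, coeff_add, coeff_X_mul', if_neg (by simp), ← hn]
          simp [coeff_X_pow]
        rw [coeff_sub, coeff_C_mul, e, mul_one, hc, sub_self]
    have hx := Algebra.subset_adjoin (R := ℂ)
      (Set.mem_singleton (X 0 ^ 2 + X 1 ^ 2 : MvPolynomial (Fin 2) ℂ))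
    rw [sub_eq_zero.mp h, ← smul_eq_C_mul]
    exact Subalgebra.smul_mem _ (Subalgebra.pow_mem _ hx n) c
  · have hc := fun i j => coeff_X_mul_pderiv p i j
    simp only [hrot, coeff_zero] at hc
    have hdesc : ∀ k ≤ n, coeff (Finsupp.single 0 (2 * (n - k)) +
        Finsupp.single 1 (2 * k + 1)) p = 0 := by
      intro k
      induction k with
      | zero =>
        intro _
        have := hc (2 * n + 1) 0
        simpa using this
      | succ k ih =>
        intro hk
        have := hc (2 * (n - (k + 1)) + 1) (2 * k + 2)
        rw [if_neg (by omega), if_neg (by omega),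
          show 2 * (n - (k + 1)) + 1 + 1 = 2 * (n - k) by omega,
          show 2 * k + 2 - 1 = 2 * k + 1 by omega, ih (by omega), zero_mul, zero_sub,
          eq_comm, neg_eq_zero, mul_eq_zero] at this
        rcases this with h | h
        · rwa [show 2 * (n - (k + 1)) + 1 - 1 = 2 * (n - (k + 1)) by omega,
            show 2 * k + 2 + 1 = 2 * (k + 1) + 1 by ring] at h
        · exfalso; exact Nat.cast_add_one_ne_zero (R := ℂ) (2 * k + 2) h
    have : p = 0 := by
      refine eq_zero_of_rot_eq_zero hp hrot ?_
      have := hdesc n le_rfl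
      simpa [hn] using this
    rw [this]
    exact Subalgebra.zero_mem _

/-! ### Directional derivatives of symbols -/

/-- The derivative of a polynomial symbol in the constant direction `ζ`. -/
def dirDeriv {R : Type*} [CommRing R] (ζ : Fin 2 → R) : Module.End R (MvPolynomial (Fin 2) R) :=
  ζ 0 • (pderiv 0).toLinearMap + ζ 1 • (pderiv 1).toLinearMap

section dirDeriv

variable {R : Type*} [CommRing R] (ζ : Fin 2 → R)

theorem dirDeriv_apply (p : MvPolynomial (Fin 2) R) :
    dirDeriv ζ p = C (ζ 0) * pderiv 0 p + C (ζ 1) * pderiv 1 p := by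
  simp [dirDeriv, smul_eq_C_mul]

theorem dirDeriv_C (r : R) : dirDeriv ζ (C r) = 0 := by simp [dirDeriv_apply]

theorem MvPolynomial.pderiv_pderiv_comm (i j : Fin 2) (p : MvPolynomial (Fin 2) R) :
    pderiv i (pderiv j p) = pderiv j (pderiv i p) := by
  have h : ⁅(pderiv i : Derivation R (MvPolynomial (Fin 2) R) _), pderiv j⁆ =
      (0 : Derivation R (MvPolynomial (Fin 2) R) _) := by
    apply MvPolynomial.derivation_ext
    intro k
    rw [Derivation.commutator_apply]
    fin_cases i <;> fin_cases j <;> fin_cases k <;> simp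
  have := congrArg (fun D : Derivation R (MvPolynomial (Fin 2) R) _ => D p) h
  rw [Derivation.commutator_apply] at this
  exact sub_eq_zero.mp this

theorem pderiv_dirDeriv (i : Fin 2) (p : MvPolynomial (Fin 2) R) :
    pderiv i (dirDeriv ζ p) = dirDeriv ζ (pderiv i p) := by
  simp only [dirDeriv_apply, map_add, pderiv_C_mul]
  rw [pderiv_pderiv_comm i 0, pderiv_pderiv_comm i 1]

theorem pderiv_dirDeriv_pow (i : Fin 2) (n : ℕ) (p : MvPolynomial (Fin 2) R) :
    pderiv i ((dirDeriv ζ ^ n) p) = (dirDeriv ζ ^ n) (pderiv i p) := by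
  induction n generalizing p with
  | zero => simp
  | succ n ih => rw [pow_succ, Module.End.mul_apply, Module.End.mul_apply, ih, pderiv_dirDeriv]

variable {ζ}

theorem MvPolynomial.sum_homogeneousComponent' (m : ℕ) (p : MvPolynomial (Fin 2) R)
    (hp : p.totalDegree ≤ m) : ∑ i ∈ Finset.range (m + 1), homogeneousComponent i p = p := by
  conv_rhs => rw [← sum_homogeneousComponent p]
  refine (Finset.sum_subset (Finset.range_mono (by omega)) ?_).symm
  intro i _ hi
  exact homogeneousComponent_eq_zero i p (by simpa using hi)

theorem MvPolynomial.IsHomogeneous.dirDeriv {p : MvPolynomial (Fin 2) R} {n : ℕ}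
    (hp : p.IsHomogeneous (n + 1)) : (dirDeriv ζ p).IsHomogeneous n := by
  rw [dirDeriv_apply]
  have h := fun i : Fin 2 => (isHomogeneous_C (Fin 2) (ζ i)).mul (hp.pderiv (i := i))
  simp only [zero_add, Nat.add_sub_cancel] at h
  exact (h 0).add (h 1)

theorem MvPolynomial.IsHomogeneous.dirDeriv_pow {p : MvPolynomial (Fin 2) R} {n k : ℕ}
    (hp : p.IsHomogeneous (n + k)) : ((_root_.dirDeriv ζ ^ n) p).IsHomogeneous k := by
  induction n generalizing p with
  | zero => simpa using hp
  | succ n ih =>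
    rw [pow_succ, Module.End.mul_apply]
    refine ih (IsHomogeneous.dirDeriv ?_)
    rwa [show n + k + 1 = n + 1 + k by ring]

/-- Euler's identity: the direction of differentiation is also the point of evaluation. -/
theorem MvPolynomial.IsHomogeneous.eval_dirDeriv {p : MvPolynomial (Fin 2) R} {n : ℕ}
    (hp : p.IsHomogeneous n) : eval ζ (_root_.dirDeriv ζ p) = n * eval ζ p := by
  have := congrArg (eval ζ) hp.sum_X_mul_pderiv
  simpa [dirDeriv_apply, Fin.sum_univ_two] using this

theorem MvPolynomial.IsHomogeneous.dirDeriv_pow_eq_C {p : MvPolynomial (Fin 2) R} {n : ℕ}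
    (hp : p.IsHomogeneous n) : (_root_.dirDeriv ζ ^ n) p = C (n.factorial * eval ζ p) := by
  induction n generalizing p with
  | zero =>
    obtain ⟨c, rfl⟩ : ∃ c, p = C c := ⟨_, totalDegree_eq_zero_iff_eq_C.mp
      (Nat.le_zero.mp hp.totalDegree_le)⟩
    simp
  | succ n ih =>
    rw [pow_succ, Module.End.mul_apply, ih hp.dirDeriv, hp.eval_dirDeriv, Nat.factorial_succ]
    push_cast
    congr 1
    ring

theorem MvPolynomial.IsHomogeneous.dirDeriv_pow_eq_zero {p : MvPolynomial (Fin 2) R} {k n : ℕ}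
    (hp : p.IsHomogeneous k) (hk : k < n) : (_root_.dirDeriv ζ ^ n) p = 0 := by
  obtain ⟨j, rfl⟩ := Nat.exists_eq_add_of_lt hk
  rw [show k + j + 1 = j + 1 + k by ring, pow_add, pow_succ, Module.End.mul_apply,
    Module.End.mul_apply, hp.dirDeriv_pow_eq_C, dirDeriv_C, map_zero]

/-- What remains is a linear form, determined by its two partial derivatives; these commute with
`dirDeriv ζ`. -/
theorem MvPolynomial.IsHomogeneous.dirDeriv_pow_eq_linear {p : MvPolynomial (Fin 2) R} {n : ℕ}
    (hp : p.IsHomogeneous (n + 1)) : (_root_.dirDeriv ζ ^ n) p =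
      C (n.factorial * eval ζ (pderiv 0 p)) * X 0 +
        C (n.factorial * eval ζ (pderiv 1 p)) * X 1 := by
  have h := (hp.dirDeriv_pow (ζ := ζ)).sum_X_mul_pderiv
  rw [one_smul, Fin.sum_univ_two, pderiv_dirDeriv_pow, pderiv_dirDeriv_pow,
    IsHomogeneous.dirDeriv_pow_eq_C (n := n) (hp.pderiv (i := 0)),
    IsHomogeneous.dirDeriv_pow_eq_C (n := n) (hp.pderiv (i := 1))] at h
  rw [← h]
  ring

theorem dirDeriv_pow_eq_C {p : MvPolynomial (Fin 2) R} {m : ℕ} (hp : p.totalDegree ≤ m) :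
    (dirDeriv ζ ^ m) p = C (m.factorial * eval ζ (homogeneousComponent m p)) := by
  have h := sum_homogeneousComponent' m p hp
  conv_lhs => rw [← h]
  rw [map_sum, Finset.sum_range_succ,
    (homogeneousComponent_isHomogeneous m p).dirDeriv_pow_eq_C, Finset.sum_eq_zero, zero_add]
  intro i hi
  exact (homogeneousComponent_isHomogeneous i p).dirDeriv_pow_eq_zero (Finset.mem_range.mp hi)

/-- Applied to a full symbol of order m + 1, this describes the m-fold commutator: a first-order
operator whose direction is the gradient of the principal symbol at ζ. -/
theorem dirDeriv_pow_eq_linear {p : MvPolynomial (Fin 2) R} {m : ℕ} (hp : p.totalDegree ≤ m + 1) :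
    (dirDeriv ζ ^ m) p =
      C (m.factorial * eval ζ (homogeneousComponent m p)) +
      (C (m.factorial * eval ζ (pderiv 0 (homogeneousComponent (m + 1) p))) * X 0 +
        C (m.factorial * eval ζ (pderiv 1 (homogeneousComponent (m + 1) p))) * X 1) := by
  have h := sum_homogeneousComponent' (m + 1) p hp
  conv_lhs => rw [← h]
  rw [map_sum, Finset.sum_range_succ, Finset.sum_range_succ,
    (homogeneousComponent_isHomogeneous m p).dirDeriv_pow_eq_C,
    (homogeneousComponent_isHomogeneous (m + 1) p).dirDeriv_pow_eq_linear,
    Finset.sum_eq_zero, zero_add]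
  intro i hi
  exact (homogeneousComponent_isHomogeneous i p).dirDeriv_pow_eq_zero (Finset.mem_range.mp hi)

end dirDeriv

/-! ### Uniqueness of derivations; derivations of Laurent series -/

/-- Two maps satisfying the Leibniz rule over a ring homomorphism out of a fraction field agree
as soon as they agree on the base ring. -/
theorem eq_of_leibniz_of_isFractionRing {R F E : Type*} [CommRing R] [IsDomain R] [Field F]
    [Algebra R F] [IsFractionRing R F] [Field E] (φ : F →+* E) {d₁ d₂ : F → E}
    (h₁ : ∀ x y, d₁ (x * y) = φ x * d₁ y + φ y * d₁ x)
    (h₂ : ∀ x y, d₂ (x * y) = φ x * d₂ y + φ y * d₂ x)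
    (h : ∀ r : R, d₁ (algebraMap R F r) = d₂ (algebraMap R F r)) (x : F) : d₁ x = d₂ x := by
  obtain ⟨r, s, hs, rfl⟩ := IsFractionRing.div_surjective (A := R) x
  have hs0 : algebraMap R F s ≠ 0 := IsFractionRing.to_map_ne_zero_of_mem_nonZeroDivisors hs
  have hr : algebraMap R F r / algebraMap R F s * algebraMap R F s = algebraMap R F r :=
    div_mul_cancel₀ _ hs0
  have e₁ := h₁ (algebraMap R F r / algebraMap R F s) (algebraMap R F s)
  have e₂ := h₂ (algebraMap R F r / algebraMap R F s) (algebraMap R F s)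
  rw [hr] at e₁ e₂
  have hφ : φ (algebraMap R F s) ≠ 0 := (map_ne_zero φ).mpr hs0
  apply mul_left_cancel₀ hφ
  have := h r
  have := h s
  grind

/-- The twisted Leibniz rule allows composites such as a derivative followed by an expansion.
Comparing them then costs only a check on constants and coordinates. -/
theorem eq_of_leibniz_ratFun2 {E : Type*} [Field E] (φ : RatFun2 →+* E) (d₁ d₂ : RatFun2 → E)
    (ha₁ : ∀ x y, d₁ (x + y) = d₁ x + d₁ y) (ha₂ : ∀ x y, d₂ (x + y) = d₂ x + d₂ y)
    (h₁ : ∀ x y, d₁ (x * y) = φ x * d₁ y + φ y * d₁ x)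
    (h₂ : ∀ x y, d₂ (x * y) = φ x * d₂ y + φ y * d₂ x)
    (hC : ∀ c : ℂ, d₁ (algebraMap ℂ RatFun2 c) = d₂ (algebraMap ℂ RatFun2 c))
    (h : ∀ i, d₁ (algebraMap (MvPolynomial (Fin 2) ℂ) RatFun2 (X i)) =
      d₂ (algebraMap (MvPolynomial (Fin 2) ℂ) RatFun2 (X i))) (x : RatFun2) : d₁ x = d₂ x := by
  refine eq_of_leibniz_of_isFractionRing (R := MvPolynomial (Fin 2) ℂ) φ h₁ h₂ (fun r => ?_) x
  induction r using MvPolynomial.induction_on with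
  | C c => exact hC c
  | add p q hp hq => rw [map_add, ha₁, ha₂, hp, hq]
  | mul_X p i hp => rw [map_mul, h₁, h₂, hp, h]

theorem eq_of_leibniz_ratFunc {E : Type*} [Field E] (φ : RatFunc ℂ →+* E) (d₁ d₂ : RatFunc ℂ → E)
    (ha₁ : ∀ x y, d₁ (x + y) = d₁ x + d₁ y) (ha₂ : ∀ x y, d₂ (x + y) = d₂ x + d₂ y)
    (h₁ : ∀ x y, d₁ (x * y) = φ x * d₁ y + φ y * d₁ x)
    (h₂ : ∀ x y, d₂ (x * y) = φ x * d₂ y + φ y * d₂ x)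
    (hC : ∀ c : ℂ, d₁ (algebraMap ℂ (RatFunc ℂ) c) = d₂ (algebraMap ℂ (RatFunc ℂ) c))
    (h : d₁ RatFunc.X = d₂ RatFunc.X) (x : RatFunc ℂ) : d₁ x = d₂ x := by
  refine eq_of_leibniz_of_isFractionRing (R := Polynomial ℂ) φ h₁ h₂ (fun r => ?_) x
  have hC' : ∀ c : ℂ, algebraMap (Polynomial ℂ) (RatFunc ℂ) (Polynomial.C c) =
      algebraMap ℂ (RatFunc ℂ) c := fun c =>
    (IsScalarTower.algebraMap_apply ℂ (Polynomial ℂ) (RatFunc ℂ) c).symm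
  induction r using Polynomial.induction_on with
  | C c => rw [hC', hC]
  | add p q hp hq => rw [map_add, ha₁, ha₂, hp, hq]
  | monomial n c hp =>
    rw [pow_succ, ← mul_assoc, map_mul, h₁, h₂, hp, RatFunc.algebraMap_X, h]

/-- The additive map `f ↦ ∑ (D fₙ + c n fₙ) Tⁿ` of Laurent series. -/
def gradedDerivation {A : Type*} [CommRing A] [Algebra ℂ A] (D : Derivation ℂ A A) (c : ℂ) :
    LaurentSeries A →+ LaurentSeries A where
  toFun f := ⟨fun n => D (f.coeff n) + (c * n) • f.coeff n,
    f.isPWO_support.mono fun n hn hf => hn (by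
      have : f.coeff n = 0 := hf
      simp [this])⟩
  map_zero' := by
    ext n
    simp
  map_add' f g := by
    ext n
    simp only [HahnSeries.coeff_add, map_add, smul_add]
    ring

theorem gradedDerivation_coeff {A : Type*} [CommRing A] [Algebra ℂ A] (D : Derivation ℂ A A) (c : ℂ)
    (f : LaurentSeries A) (n : ℤ) :
    (gradedDerivation D c f).coeff n = D (f.coeff n) + (c * n) • f.coeff n := rfl

theorem gradedDerivation_leibniz {A : Type*} [CommRing A] [Algebra ℂ A] (D : Derivation ℂ A A)
    (c : ℂ) (f g : LaurentSeries A) :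
    gradedDerivation D c (f * g) = f * gradedDerivation D c g + g * gradedDerivation D c f := by
  have hsub : ∀ f : LaurentSeries A, (gradedDerivation D c f).support ⊆ f.support :=
    fun f n hn hf => hn (by
      have : f.coeff n = 0 := hf
      simp [gradedDerivation_coeff, this])
  ext n
  -- The derivatives are supported inside the supports of `f` and `g`, so all three convolutions run
  -- over the same index set.
  rw [gradedDerivation_coeff, HahnSeries.coeff_add, HahnSeries.coeff_mul,
    HahnSeries.coeff_mul_right' g.isPWO_support (hsub g), mul_comm g,
    HahnSeries.coeff_mul_left' f.isPWO_support (hsub f), map_sum, Finset.smul_sum,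
    ← Finset.sum_add_distrib, ← Finset.sum_add_distrib]
  refine Finset.sum_congr rfl fun ij hij => ?_
  have hn : ij.1 + ij.2 = n := (Finset.mem_antidiagonal.mp hij).2.2
  rw [← hn, Derivation.leibniz, gradedDerivation_coeff, gradedDerivation_coeff]
  simp only [smul_eq_mul, Algebra.smul_def, map_mul, Int.cast_add, map_add]
  ring

theorem gradedDerivation_single {A : Type*} [CommRing A] [Algebra ℂ A] (D : Derivation ℂ A A)
    (c : ℂ) (m : ℤ) (r : A) :
    gradedDerivation D c (HahnSeries.single m r) = HahnSeries.single m (D r + (c * m) • r) := by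
  ext n
  rw [gradedDerivation_coeff]
  by_cases h : n = m
  · subst h; simp
  · simp [HahnSeries.coeff_single_of_ne h]

/-! ### The derivative on ℂ(z) -/

/-- The ring homomorphism `F ↦ F + ε F'` on polynomials. -/
def polynomialToDual : Polynomial ℂ →ₐ[ℂ] DualNumber (RatFunc ℂ) :=
  Polynomial.aeval (TrivSqZeroExt.inl RatFunc.X + TrivSqZeroExt.inr 1)

theorem polynomialToDual_fst (p : Polynomial ℂ) :
    (polynomialToDual p).fst = algebraMap _ (RatFunc ℂ) p := by
  have h : (TrivSqZeroExt.fstHom ℂ (RatFunc ℂ) (RatFunc ℂ)).comp polynomialToDual =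
      Algebra.algHom ℂ (Polynomial ℂ) (RatFunc ℂ) := by
    apply Polynomial.algHom_ext
    simp only [polynomialToDual, AlgHom.comp_apply, Polynomial.aeval_X]
    change _ = algebraMap (Polynomial ℂ) (RatFunc ℂ) Polynomial.X
    rw [RatFunc.algebraMap_X]
    simp
  exact congrArg (fun φ : Polynomial ℂ →ₐ[ℂ] RatFunc ℂ => φ p) h

theorem polynomialToDual_isUnit (s : nonZeroDivisors (Polynomial ℂ)) :
    IsUnit (polynomialToDual (s : Polynomial ℂ)) := by
  rw [TrivSqZeroExt.isUnit_iff_isUnit_fst, polynomialToDual_fst]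
  exact IsLocalization.map_units (RatFunc ℂ) s

/-- The extension of `F ↦ F + ε F'` to rational functions of one variable. -/
def ratFuncToDual : RatFunc ℂ →ₐ[ℂ] DualNumber (RatFunc ℂ) :=
  IsLocalization.liftAlgHom (M := nonZeroDivisors (Polynomial ℂ)) (f := polynomialToDual)
    polynomialToDual_isUnit

theorem ratFuncToDual_algebraMap (p : Polynomial ℂ) :
    ratFuncToDual (algebraMap _ (RatFunc ℂ) p) = polynomialToDual p :=
  IsLocalization.lift_eq _ _

theorem ratFuncToDual_fst (F : RatFunc ℂ) : (ratFuncToDual F).fst = F := by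
  have h : ((TrivSqZeroExt.fstHom ℂ (RatFunc ℂ) (RatFunc ℂ)).comp ratFuncToDual :
      RatFunc ℂ →ₐ[ℂ] RatFunc ℂ).toRingHom = RingHom.id (RatFunc ℂ) := by
    apply IsLocalization.ringHom_ext (nonZeroDivisors (Polynomial ℂ))
    apply RingHom.ext
    intro f
    change (ratFuncToDual (algebraMap _ (RatFunc ℂ) f)).fst = algebraMap _ (RatFunc ℂ) f
    rw [ratFuncToDual_algebraMap, polynomialToDual_fst]
  exact congrArg (fun φ : RatFunc ℂ →+* RatFunc ℂ => φ F) h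

/-- The derivative `d/dz` on `ℂ(z)`. -/
def ratDeriv : Derivation ℂ (RatFunc ℂ) (RatFunc ℂ) :=
  Derivation.mk'
    { toFun := fun F => (ratFuncToDual F).snd
      map_add' := fun F G => by simp
      map_smul' := fun c F => by simp }
    (fun F G => by
      simp only [LinearMap.coe_mk, AddHom.coe_mk]
      rw [map_mul, TrivSqZeroExt.snd_mul, ratFuncToDual_fst, ratFuncToDual_fst]
      simp [mul_comm])

theorem ratDeriv_X : ratDeriv RatFunc.X = 1 := by
  change (ratFuncToDual RatFunc.X).snd = 1
  rw [← RatFunc.algebraMap_X, ratFuncToDual_algebraMap]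
  simp [polynomialToDual]

/-! ### Expansion of polynomials in homogeneous components -/

/-- The linear coordinates `(x₁, x₂)` of the point with `a x₁ + b x₂ = z` and
`-b x₁ + a x₂ = 1`, as polynomials in `z`. -/
def lineParam (a b : ℂ) : Fin 2 → Polynomial ℂ :=
  ![Polynomial.C (a / (a ^ 2 + b ^ 2)) * Polynomial.X - Polynomial.C (b / (a ^ 2 + b ^ 2)),
    Polynomial.C (b / (a ^ 2 + b ^ 2)) * Polynomial.X + Polynomial.C (a / (a ^ 2 + b ^ 2))]

/-- Restriction of a polynomial in two variables to the line `-b x₁ + a x₂ = 1`. -/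
def restrictLine (a b : ℂ) : MvPolynomial (Fin 2) ℂ →ₐ[ℂ] Polynomial ℂ := aeval (lineParam a b)

/-- The constants in the Laurent series over `ℂ(z)`. -/
def laurentConst : ℂ →+* LaurentSeries (RatFunc ℂ) :=
  HahnSeries.C.comp (algebraMap ℂ (RatFunc ℂ))

/-- Expansion of a polynomial in homogeneous components. -/
def polyExpand (a b : ℂ) : MvPolynomial (Fin 2) ℂ →+* LaurentSeries (RatFunc ℂ) :=
  eval₂Hom laurentConst
    fun i => HahnSeries.single 1 (algebraMap (Polynomial ℂ) (RatFunc ℂ) (lineParam a b i))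

theorem MvPolynomial.IsHomogeneous.eval₂_mul {A : Type*} [CommRing A] (f : ℂ →+* A)
    {p : MvPolynomial (Fin 2) ℂ} {n : ℕ} (hp : p.IsHomogeneous n) (w : A) (x : Fin 2 → A) :
    MvPolynomial.eval₂ f (fun i => w * x i) p = w ^ n * MvPolynomial.eval₂ f x p := by
  rw [eval₂_eq', eval₂_eq', Finset.mul_sum]
  refine Finset.sum_congr rfl fun d hd => ?_
  have : d.degree = n := by
    by_contra h
    exact (mem_support_iff.mp hd) (hp.coeff_eq_zero h)
  rw [Finsupp.degree_eq_sum] at this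
  simp only [Fin.sum_univ_two, Fin.prod_univ_two] at this ⊢
  rw [← this]
  ring

theorem polyExpand_of_isHomogeneous (a b : ℂ) {p : MvPolynomial (Fin 2) ℂ} {n : ℕ}
    (hp : p.IsHomogeneous n) :
    polyExpand a b p = HahnSeries.single (n : ℤ)
      (algebraMap (Polynomial ℂ) (RatFunc ℂ) (restrictLine a b p)) := by
  have h : polyExpand a b = eval₂Hom laurentConst fun i =>
      (HahnSeries.single (1 : ℤ) (1 : RatFunc ℂ)) *
      HahnSeries.C (algebraMap (Polynomial ℂ) (RatFunc ℂ) (lineParam a b i)) := by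
    rw [polyExpand]
    congr 1
    funext i
    rw [HahnSeries.C_apply, HahnSeries.single_mul_single, add_zero, one_mul]
  have h2 : eval₂ laurentConst (fun i => HahnSeries.C (Γ := ℤ)
      (algebraMap (Polynomial ℂ) (RatFunc ℂ) (lineParam a b i))) p =
      HahnSeries.C (algebraMap (Polynomial ℂ) (RatFunc ℂ) (restrictLine a b p)) := by
    have : eval₂Hom laurentConst (fun i => HahnSeries.C (Γ := ℤ)
      (algebraMap (Polynomial ℂ) (RatFunc ℂ) (lineParam a b i))) =
      (HahnSeries.C.comp (algebraMap (Polynomial ℂ) (RatFunc ℂ))).comp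
        (restrictLine a b : MvPolynomial (Fin 2) ℂ →+* Polynomial ℂ) := by
      apply MvPolynomial.ringHom_ext
      · intro r
        simp [laurentConst]
      · intro i
        simp [restrictLine]
    exact congrArg (fun φ : MvPolynomial (Fin 2) ℂ →+* LaurentSeries (RatFunc ℂ) => φ p) this
  rw [h, coe_eval₂Hom, hp.eval₂_mul, h2, HahnSeries.single_pow, HahnSeries.C_apply,
    HahnSeries.single_mul_single]
  simp

/-- Every point with y ≠ 0 is a multiple of a point of the line y = 1, so a form vanishing on that
line vanishes after multiplication by y. -/
theorem restrictLine_eq_zero {a b : ℂ} (hN : a ^ 2 + b ^ 2 ≠ 0) {p : MvPolynomial (Fin 2) ℂ}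
    {n : ℕ} (hp : p.IsHomogeneous n) (h : restrictLine a b p = 0) : p = 0 := by
  have key : p * (C (-b) * X 0 + C a * X 1) = 0 := by
    apply MvPolynomial.funext
    intro x
    simp only [map_mul, map_add, eval_C, eval_X, map_zero]
    by_cases hw : -b * x 0 + a * x 1 = 0
    · rw [hw, mul_zero]
    · set w := -b * x 0 + a * x 1 with hwdef
      have hz : x = fun i => w * Polynomial.eval ((a * x 0 + b * x 1) / w) (lineParam a b i) := by
        funext i
        fin_cases i
        · simp [lineParam]; field_simp; rw [hwdef]; ring
        · simp [lineParam]; field_simp; rw [hwdef]; ring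
      have h1 : eval x p = 0 := by
        have h2 := congrArg (Polynomial.aeval ((a * x 0 + b * x 1) / w)) h
        rw [restrictLine, ← AlgHom.comp_apply, MvPolynomial.comp_aeval, map_zero] at h2
        simp only [Polynomial.coe_aeval_eq_eval, aeval_def, Algebra.algebraMap_self] at h2
        rw [← MvPolynomial.eval₂_id, hz, hp.eval₂_mul, h2, mul_zero]
      rw [h1, zero_mul]
  rcases mul_eq_zero.mp key with h | h
  · exact h
  · exfalso
    have h0 := congrArg (eval ![(1 : ℂ), 0]) h
    have h1 := congrArg (eval ![(0 : ℂ), 1]) h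
    simp at h0 h1
    exact hN (by rw [h0, h1]; ring)

/-- Components of different degrees land in different powers and cannot cancel. Injectivity into a
field is what lets the expansion extend to ℂ(x₁, x₂). -/
theorem polyExpand_injective {a b : ℂ} (hN : a ^ 2 + b ^ 2 ≠ 0) :
    Function.Injective (polyExpand a b) := by
  rw [injective_iff_map_eq_zero]
  intro p hp
  rw [← sum_homogeneousComponent p] at hp ⊢
  refine Finset.sum_eq_zero fun n hn => ?_
  refine restrictLine_eq_zero hN (homogeneousComponent_isHomogeneous n p) ?_
  rw [map_sum] at hp
  have h := congrArg (fun f : LaurentSeries (RatFunc ℂ) => f.coeff n) hp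
  simp only [HahnSeries.coeff_sum, HahnSeries.coeff_zero] at h
  rw [Finset.sum_eq_single_of_mem n hn, polyExpand_of_isHomogeneous a b
    (homogeneousComponent_isHomogeneous n p), HahnSeries.coeff_single_same] at h
  · exact (map_eq_zero_iff _ (RatFunc.algebraMap_injective ℂ)).mp h
  · intro m _ hm
    rw [polyExpand_of_isHomogeneous a b (homogeneousComponent_isHomogeneous m p),
      HahnSeries.coeff_single_of_ne (by exact_mod_cast hm.symm)]

/-! ### Coordinates adapted to one line -/

/-- The coordinate function `xᵢ`. -/
def ratX (i : Fin 2) : RatFun2 := algebraMap (MvPolynomial (Fin 2) ℂ) RatFun2 (X i)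

theorem ratPderiv_ratX_self (i : Fin 2) : ratPderiv i (ratX i) = 1 := by
  rw [ratX, ratPderiv_algebraMap, pderiv_X_self, map_one]

theorem ratPderiv_ratX_of_ne {i j : Fin 2} (h : j ≠ i) : ratPderiv i (ratX j) = 0 := by
  rw [ratX, ratPderiv_algebraMap, pderiv_X_of_ne h, map_zero]

/-- The constants in `ℂ(x₁, x₂)`. -/
def ratC : ℂ →+* RatFun2 := algebraMap ℂ RatFun2

theorem Derivation.map_ratC (D : Derivation ℂ RatFun2 RatFun2) (c : ℂ) : D (ratC c) = 0 :=
  D.map_algebraMap c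

theorem Derivation.map_ratC_mul (D : Derivation ℂ RatFun2 RatFun2) (c : ℂ) (f : RatFun2) :
    D (ratC c * f) = ratC c * D f := by
  rw [Derivation.leibniz, D.map_ratC]
  simp

theorem ratPderiv_zero_linear (p q : ℂ) :
    ratPderiv 0 (ratC p * ratX 0 + ratC q * ratX 1) = ratC p := by
  rw [map_add, Derivation.map_ratC_mul, Derivation.map_ratC_mul, ratPderiv_ratX_self,
    ratPderiv_ratX_of_ne (by decide), mul_one, mul_zero, add_zero]

theorem ratPderiv_one_linear (p q : ℂ) :
    ratPderiv 1 (ratC p * ratX 0 + ratC q * ratX 1) = ratC q := by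
  rw [map_add, Derivation.map_ratC_mul, Derivation.map_ratC_mul, ratPderiv_ratX_self,
    ratPderiv_ratX_of_ne (by decide), mul_one, mul_zero, zero_add]

/-- The coordinate `a x₁ + b x₂`. -/
def coordT (a b : ℂ) : RatFun2 := ratC a * ratX 0 + ratC b * ratX 1

/-- The coordinate `-b x₁ + a x₂`. -/
def coordY (a b : ℂ) : RatFun2 := ratC (-b) * ratX 0 + ratC a * ratX 1

/-- The derivation dual to `coordT` in the coordinates `coordT`, `coordY`. -/
def derivT (a b : ℂ) : Derivation ℂ RatFun2 RatFun2 :=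
  ratC (a / (a ^ 2 + b ^ 2)) • ratPderiv 0 + ratC (b / (a ^ 2 + b ^ 2)) • ratPderiv 1

/-- The derivation dual to `coordY` in the coordinates `coordT`, `coordY`. -/
def derivY (a b : ℂ) : Derivation ℂ RatFun2 RatFun2 :=
  ratC (-b / (a ^ 2 + b ^ 2)) • ratPderiv 0 + ratC (a / (a ^ 2 + b ^ 2)) • ratPderiv 1

theorem derivT_apply (a b : ℂ) (f : RatFun2) : derivT a b f =
    ratC (a / (a ^ 2 + b ^ 2)) * ratPderiv 0 f + ratC (b / (a ^ 2 + b ^ 2)) * ratPderiv 1 f := rfl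

theorem derivY_apply (a b : ℂ) (f : RatFun2) : derivY a b f =
    ratC (-b / (a ^ 2 + b ^ 2)) * ratPderiv 0 f + ratC (a / (a ^ 2 + b ^ 2)) * ratPderiv 1 f := rfl

theorem polyExpand_isUnit {a b : ℂ} (hN : a ^ 2 + b ^ 2 ≠ 0)
    (s : nonZeroDivisors (MvPolynomial (Fin 2) ℂ)) : IsUnit (polyExpand a b s) :=
  IsUnit.mk0 (G₀ := LaurentSeries (RatFunc ℂ)) _ ((map_ne_zero_iff _ (polyExpand_injective hN)).mpr
    (nonZeroDivisors.ne_zero s.2))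

/-! ### Homogeneous components of rational functions -/

section coordinates

variable {a b : ℂ} (hN : a ^ 2 + b ^ 2 ≠ 0)

/-- Expansion of a rational function at the origin in homogeneous components. -/
def homExpand : RatFun2 →+* LaurentSeries (RatFunc ℂ) :=
  IsLocalization.lift (M := nonZeroDivisors (MvPolynomial (Fin 2) ℂ)) (polyExpand_isUnit hN)

theorem homExpand_algebraMap (p : MvPolynomial (Fin 2) ℂ) :
    homExpand hN (algebraMap _ RatFun2 p) = polyExpand a b p :=
  IsLocalization.lift_eq _ _

theorem homExpand_ratX (i : Fin 2) : homExpand hN (ratX i) =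
    HahnSeries.single 1 (algebraMap (Polynomial ℂ) (RatFunc ℂ) (lineParam a b i)) := by
  rw [ratX, homExpand_algebraMap, polyExpand, coe_eval₂Hom, eval₂_X]

theorem homExpand_const (c : ℂ) : homExpand hN (ratC c) =
    HahnSeries.C (algebraMap ℂ (RatFunc ℂ) c) := by
  have : ratC c = algebraMap (MvPolynomial (Fin 2) ℂ) RatFun2 (C c) := rfl
  rw [this, homExpand_algebraMap, polyExpand, coe_eval₂Hom, eval₂_C]
  rfl

/-- The homogeneous component of degree `n` of a rational function. -/
def homComp (n : ℤ) : RatFun2 →ₗ[ℂ] RatFunc ℂ where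
  toFun f := (homExpand hN f).coeff n
  map_add' f g := by rw [map_add, HahnSeries.coeff_add]
  map_smul' c f := by
    rw [Algebra.smul_def]
    change (homExpand hN (ratC c * f)).coeff n = _
    rw [map_mul, homExpand_const, HahnSeries.C_apply,
      HahnSeries.coeff_single_zero_mul, RingHom.id_apply, Algebra.smul_def]

theorem homComp_apply (n : ℤ) (f : RatFun2) : homComp hN n f = (homExpand hN f).coeff n := rfl

theorem algebraMap_lineParam_zero : algebraMap (Polynomial ℂ) (RatFunc ℂ) (lineParam a b 0) =
    (a / (a ^ 2 + b ^ 2)) • RatFunc.X - algebraMap ℂ _ (b / (a ^ 2 + b ^ 2)) := by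
  have h : ∀ c : ℂ, algebraMap (Polynomial ℂ) (RatFunc ℂ) (Polynomial.C c) =
      algebraMap ℂ (RatFunc ℂ) c := fun _ => rfl
  simp only [lineParam, Matrix.cons_val_zero, map_sub, map_mul, h, RatFunc.algebraMap_X,
    Algebra.smul_def]

theorem algebraMap_lineParam_one : algebraMap (Polynomial ℂ) (RatFunc ℂ) (lineParam a b 1) =
    (b / (a ^ 2 + b ^ 2)) • RatFunc.X + algebraMap ℂ _ (a / (a ^ 2 + b ^ 2)) := by
  have h : ∀ c : ℂ, algebraMap (Polynomial ℂ) (RatFunc ℂ) (Polynomial.C c) =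
      algebraMap ℂ (RatFunc ℂ) c := fun _ => rfl
  simp only [lineParam, Matrix.cons_val_one, map_add, map_mul, h, RatFunc.algebraMap_X,
    Algebra.smul_def, Matrix.cons_val_fin_one]

theorem homExpand_coordT : homExpand hN (coordT a b) = HahnSeries.single 1 RatFunc.X := by
  rw [coordT, map_add, map_mul, map_mul, homExpand_const, homExpand_const, homExpand_ratX, homExpand_ratX,
    HahnSeries.C_apply, HahnSeries.C_apply, HahnSeries.single_mul_single,
    HahnSeries.single_mul_single, zero_add, ← HahnSeries.single_add, algebraMap_lineParam_zero,
    algebraMap_lineParam_one]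
  congr 1
  simp only [Algebra.smul_def]
  have h := congrArg (algebraMap ℂ (RatFunc ℂ))
    (show a * (a / (a ^ 2 + b ^ 2)) + b * (b / (a ^ 2 + b ^ 2)) = 1 by field_simp)
  have h' := congrArg (algebraMap ℂ (RatFunc ℂ))
    (show -(a * (b / (a ^ 2 + b ^ 2))) + b * (a / (a ^ 2 + b ^ 2)) = 0 by ring)
  simp only [map_add, map_mul, map_one, map_neg, map_zero] at h h'
  linear_combination RatFunc.X * h + h'

theorem homExpand_coordY : homExpand hN (coordY a b) = HahnSeries.single 1 1 := by
  rw [coordY, map_add, map_mul, map_mul, homExpand_const, homExpand_const, homExpand_ratX, homExpand_ratX,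
    HahnSeries.C_apply, HahnSeries.C_apply, HahnSeries.single_mul_single,
    HahnSeries.single_mul_single, zero_add, ← HahnSeries.single_add, algebraMap_lineParam_zero,
    algebraMap_lineParam_one]
  congr 1
  simp only [Algebra.smul_def]
  have h := congrArg (algebraMap ℂ (RatFunc ℂ))
    (show a * (a / (a ^ 2 + b ^ 2)) + b * (b / (a ^ 2 + b ^ 2)) = 1 by field_simp)
  have h' := congrArg (algebraMap ℂ (RatFunc ℂ))
    (show -(b * (a / (a ^ 2 + b ^ 2))) + a * (b / (a ^ 2 + b ^ 2)) = 0 by ring)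
  simp only [map_add, map_mul, map_one, map_neg, map_zero] at h h' ⊢
  linear_combination RatFunc.X * h' + h

end coordinates

theorem coordY_ne_zero {a b : ℂ} (hN : a ^ 2 + b ^ 2 ≠ 0) : coordY a b ≠ 0 := by
  intro h
  have := homExpand_coordY hN
  rw [h, map_zero] at this
  have := congrArg (fun f : LaurentSeries (RatFunc ℂ) => f.coeff 1) this
  simp at this

theorem derivT_coordT {a b : ℂ} (hN : a ^ 2 + b ^ 2 ≠ 0) : derivT a b (coordT a b) = 1 := by
  simp only [derivT_apply, coordT, ratPderiv_zero_linear, ratPderiv_one_linear, ← map_mul, ← map_add]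
  rw [show a / (a ^ 2 + b ^ 2) * a + b / (a ^ 2 + b ^ 2) * b = 1 by field_simp, map_one]

theorem derivY_coordY {a b : ℂ} (hN : a ^ 2 + b ^ 2 ≠ 0) : derivY a b (coordY a b) = 1 := by
  simp only [derivY_apply, coordY, ratPderiv_zero_linear, ratPderiv_one_linear, ← map_mul, ← map_add]
  rw [show -b / (a ^ 2 + b ^ 2) * -b + a / (a ^ 2 + b ^ 2) * a = 1 by field_simp; ring, map_one]

theorem ratPderiv_zero_eq {a b : ℂ} (hN : a ^ 2 + b ^ 2 ≠ 0) (f : RatFun2) :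
    ratPderiv 0 f = ratC a * derivT a b f + ratC (-b) * derivY a b f := by
  have h := congrArg ratC
    (show a * (a / (a ^ 2 + b ^ 2)) + -b * (-b / (a ^ 2 + b ^ 2)) = 1 by field_simp)
  have h' := congrArg ratC
    (show a * (b / (a ^ 2 + b ^ 2)) + -b * (a / (a ^ 2 + b ^ 2)) = 0 by ring)
  simp only [map_add, map_mul ratC, map_zero, map_one] at h h'
  simp only [derivT_apply, derivY_apply]
  linear_combination (-ratPderiv 0 f) * h - ratPderiv 1 f * h'

theorem ratPderiv_one_eq {a b : ℂ} (hN : a ^ 2 + b ^ 2 ≠ 0) (f : RatFun2) :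
    ratPderiv 1 f = ratC b * derivT a b f + ratC a * derivY a b f := by
  have h := congrArg ratC
    (show b * (b / (a ^ 2 + b ^ 2)) + a * (a / (a ^ 2 + b ^ 2)) = 1 by field_simp; ring)
  have h' := congrArg ratC
    (show b * (a / (a ^ 2 + b ^ 2)) + a * (-b / (a ^ 2 + b ^ 2)) = 0 by ring)
  simp only [map_add, map_mul ratC, map_zero, map_one] at h h'
  simp only [derivT_apply, derivY_apply]
  linear_combination (-ratPderiv 1 f) * h - ratPderiv 0 f * h'

theorem derivT_coordY (a b : ℂ) : derivT a b (coordY a b) = 0 := by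
  simp only [derivT_apply, coordY, ratPderiv_zero_linear, ratPderiv_one_linear, ← map_mul, ← map_add]
  rw [show a / (a ^ 2 + b ^ 2) * -b + b / (a ^ 2 + b ^ 2) * a = 0 by ring, map_zero]

theorem derivY_coordT (a b : ℂ) : derivY a b (coordT a b) = 0 := by
  simp only [derivY_apply, coordT, ratPderiv_zero_linear, ratPderiv_one_linear, ← map_mul, ← map_add]
  rw [show -b / (a ^ 2 + b ^ 2) * a + a / (a ^ 2 + b ^ 2) * b = 0 by ring, map_zero]

theorem ratPderiv_ratX (i j : Fin 2) : ratPderiv i (ratX j) = if j = i then 1 else 0 := by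
  split_ifs with h
  · rw [h, ratPderiv_ratX_self]
  · exact ratPderiv_ratX_of_ne h

theorem ratDeriv_algebraMap (c : ℂ) : ratDeriv (algebraMap ℂ (RatFunc ℂ) c) = 0 :=
  ratDeriv.map_algebraMap c

theorem ratDeriv_algebraMap_mul (c : ℂ) (F : RatFunc ℂ) :
    ratDeriv (algebraMap ℂ (RatFunc ℂ) c * F) = algebraMap ℂ (RatFunc ℂ) c * ratDeriv F := by
  rw [Derivation.leibniz, ratDeriv_algebraMap]
  simp

/-! ### Derivatives on homogeneous components, and homogeneous lifts -/

section coordinates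

variable {a b : ℂ} (hN : a ^ 2 + b ^ 2 ≠ 0)

/-- The factor y makes the operator preserve degree: y ∂_t sends F(z) yⁿ to F'(z) yⁿ. -/
theorem homExpand_coordY_mul_derivT (f : RatFun2) :
    homExpand hN (coordY a b * derivT a b f) = gradedDerivation ratDeriv 0 (homExpand hN f) := by
  refine eq_of_leibniz_ratFun2 (E := LaurentSeries (RatFunc ℂ)) (homExpand hN)
    (fun f => homExpand hN (coordY a b * derivT a b f))
    (fun f => gradedDerivation ratDeriv 0 (homExpand hN f))
    (fun f g => by rw [map_add, mul_add, map_add])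
    (fun f g => by rw [map_add, map_add]) ?_ ?_ ?_ ?_ f
  · intro x y
    simp only [Derivation.leibniz, smul_eq_mul, map_add, map_mul]
    ring
  · intro x y
    simp only [map_mul, gradedDerivation_leibniz]
  · intro c
    change homExpand hN (coordY a b * derivT a b (ratC c)) =
      gradedDerivation ratDeriv 0 (homExpand hN (ratC c))
    rw [Derivation.map_ratC, mul_zero, map_zero, homExpand_const, HahnSeries.C_apply,
      gradedDerivation_single, ratDeriv_algebraMap]
    simp
  · intro i
    change homExpand hN (coordY a b * derivT a b (ratX i)) =
      gradedDerivation ratDeriv 0 (homExpand hN (ratX i))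
    rw [homExpand_ratX, gradedDerivation_single, map_mul, homExpand_coordY, derivT_apply,
      ratPderiv_ratX, ratPderiv_ratX]
    fin_cases i
    · simp only [Fin.zero_eta, if_true, Fin.isValue, zero_ne_one, if_false, mul_one, mul_zero,
        add_zero, homExpand_const]
      rw [algebraMap_lineParam_zero, HahnSeries.C_apply, HahnSeries.single_mul_single,
        map_sub, ratDeriv_algebraMap, Algebra.smul_def, ratDeriv_algebraMap_mul, ratDeriv_X]
      simp
    · simp only [Fin.mk_one, if_true, Fin.isValue, one_ne_zero, if_false, mul_one, mul_zero,
        zero_add, homExpand_const]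
      rw [algebraMap_lineParam_one, HahnSeries.C_apply, HahnSeries.single_mul_single,
        map_add ratDeriv, ratDeriv_algebraMap, Algebra.smul_def, ratDeriv_algebraMap_mul, ratDeriv_X]
      simp

theorem euler_ratX (hN : a ^ 2 + b ^ 2 ≠ 0) (i : Fin 2) :
    coordT a b * derivT a b (ratX i) + coordY a b * derivY a b (ratX i) = ratX i := by
  have h := congrArg ratC
    (show a * (a / (a ^ 2 + b ^ 2)) + -b * (-b / (a ^ 2 + b ^ 2)) = 1 by field_simp)
  have h' := congrArg ratC
    (show b * (a / (a ^ 2 + b ^ 2)) + a * (-b / (a ^ 2 + b ^ 2)) = 0 by ring)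
  have h2 := congrArg ratC
    (show b * (b / (a ^ 2 + b ^ 2)) + a * (a / (a ^ 2 + b ^ 2)) = 1 by field_simp; ring)
  have h3 := congrArg ratC
    (show a * (b / (a ^ 2 + b ^ 2)) + -b * (a / (a ^ 2 + b ^ 2)) = 0 by ring)
  simp only [map_add, map_mul ratC, map_zero, map_one] at h h' h2 h3
  rw [derivT_apply, derivY_apply, ratPderiv_ratX, ratPderiv_ratX, coordT, coordY]
  fin_cases i
  · simp only [Fin.zero_eta, if_true, Fin.isValue, zero_ne_one, if_false, mul_one, mul_zero,
      add_zero]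
    linear_combination ratX 0 * h + ratX 1 * h'
  · simp only [Fin.mk_one, if_true, Fin.isValue, one_ne_zero, if_false, mul_one, mul_zero,
      zero_add]
    linear_combination ratX 1 * h2 + ratX 0 * h3

/-- The Euler field multiplies the component of degree n by n. Together with the formula for y ∂_t
it determines the action of ∂_y. -/
theorem homExpand_euler (f : RatFun2) :
    homExpand hN (coordT a b * derivT a b f + coordY a b * derivY a b f) =
      gradedDerivation 0 1 (homExpand hN f) := by
  refine eq_of_leibniz_ratFun2 (E := LaurentSeries (RatFunc ℂ)) (homExpand hN)
    (fun f => homExpand hN (coordT a b * derivT a b f + coordY a b * derivY a b f))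
    (fun f => gradedDerivation 0 1 (homExpand hN f))
    (fun f g => by rw [← map_add]; congr 1; rw [map_add, map_add]; ring)
    (fun f g => by rw [map_add, map_add]) ?_ ?_ ?_ ?_ f
  · intro x y
    simp only [Derivation.leibniz, smul_eq_mul, map_add, map_mul]
    ring
  · intro x y
    simp only [map_mul, gradedDerivation_leibniz]
  · intro c
    change homExpand hN (coordT a b * derivT a b (ratC c) + coordY a b * derivY a b (ratC c)) =
      gradedDerivation 0 1 (homExpand hN (ratC c))
    rw [Derivation.map_ratC, Derivation.map_ratC, mul_zero, mul_zero, add_zero, map_zero,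
      homExpand_const, HahnSeries.C_apply, gradedDerivation_single]
    simp
  · intro i
    change homExpand hN (coordT a b * derivT a b (ratX i) + coordY a b * derivY a b (ratX i)) =
      gradedDerivation 0 1 (homExpand hN (ratX i))
    rw [euler_ratX hN, homExpand_ratX, gradedDerivation_single]
    simp

theorem homComp_coordY_mul (n : ℤ) (f : RatFun2) :
    homComp hN (n + 1) (coordY a b * f) = homComp hN n f := by
  rw [homComp_apply, map_mul, homExpand_coordY, add_comm, HahnSeries.coeff_single_mul]
  simp [homComp_apply]

theorem homComp_coordT_mul (n : ℤ) (f : RatFun2) :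
    homComp hN (n + 1) (coordT a b * f) = RatFunc.X * homComp hN n f := by
  rw [homComp_apply, map_mul, homExpand_coordT, add_comm, HahnSeries.coeff_single_mul]
  simp [homComp_apply]

theorem homComp_derivT (n : ℤ) (f : RatFun2) :
    homComp hN n (derivT a b f) = ratDeriv (homComp hN (n + 1) f) := by
  rw [← homComp_coordY_mul, homComp_apply, homExpand_coordY_mul_derivT, gradedDerivation_coeff]
  simp [homComp_apply]

theorem homComp_derivY (n : ℤ) (f : RatFun2) :
    homComp hN n (derivY a b f) =
      ((n + 1 : ℤ) : ℂ) • homComp hN (n + 1) f - RatFunc.X * ratDeriv (homComp hN (n + 1) f) := by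
  have h := congrArg (fun g : LaurentSeries (RatFunc ℂ) => g.coeff (n + 1)) (homExpand_euler hN f)
  simp only [gradedDerivation_coeff, Derivation.zero_apply, zero_add, one_mul] at h
  rw [← homComp_apply, ← homComp_apply, map_add, homComp_coordT_mul, homComp_coordY_mul,
    homComp_derivT] at h
  rw [← h]
  ring

theorem homExpand_coordT_div_coordY :
    homExpand hN (coordT a b / coordY a b) = HahnSeries.C RatFunc.X := by
  have h : homExpand hN (coordT a b / coordY a b) * homExpand hN (coordY a b) =
      HahnSeries.C RatFunc.X * homExpand hN (coordY a b) := by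
    rw [← map_mul, div_mul_cancel₀ _ (coordY_ne_zero hN), homExpand_coordT, homExpand_coordY,
      HahnSeries.C_apply, HahnSeries.single_mul_single]
    simp
  exact mul_right_cancel₀ ((map_ne_zero _).mpr (coordY_ne_zero hN)) h

theorem homExpand_eval₂ (p : Polynomial ℂ) :
    homExpand hN (Polynomial.eval₂RingHom ratC (coordT a b / coordY a b) p) =
      HahnSeries.C (algebraMap (Polynomial ℂ) (RatFunc ℂ) p) := by
  have : (homExpand hN).comp (Polynomial.eval₂RingHom ratC (coordT a b / coordY a b)) =
      HahnSeries.C.comp (algebraMap (Polynomial ℂ) (RatFunc ℂ)) := by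
    apply Polynomial.ringHom_ext
    · intro c
      simp only [RingHom.comp_apply, Polynomial.coe_eval₂RingHom, Polynomial.eval₂_C,
        homExpand_const]
      rfl
    · simp only [RingHom.comp_apply, Polynomial.coe_eval₂RingHom, Polynomial.eval₂_X,
        homExpand_coordT_div_coordY, RatFunc.algebraMap_X]
  exact congrArg (fun φ : Polynomial ℂ →+* LaurentSeries (RatFunc ℂ) => φ p) this

/-- The expansion of p(t / y) is the constant series p(z), which is nonzero; hence p(t / y) is
nonzero too. -/
theorem eval₂_isUnit (hN : a ^ 2 + b ^ 2 ≠ 0) (s : nonZeroDivisors (Polynomial ℂ)) :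
    IsUnit (Polynomial.eval₂RingHom ratC (coordT a b / coordY a b) (s : Polynomial ℂ)) := by
  refine IsUnit.mk0 (G₀ := RatFun2) _ fun h => ?_
  have h2 := homExpand_eval₂ hN s
  rw [h, map_zero] at h2
  exact nonZeroDivisors.ne_zero s.2 ((map_eq_zero_iff _ (RatFunc.algebraMap_injective ℂ)).mp
    (HahnSeries.C_injective (by rw [← h2, map_zero])))

/-- The embedding `ℂ(z) → ℂ(x₁, x₂)` as rational functions homogeneous of degree zero. -/
def ratSlice : RatFunc ℂ →+* RatFun2 :=
  IsLocalization.lift (M := nonZeroDivisors (Polynomial ℂ)) (eval₂_isUnit hN)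

theorem ratSlice_algebraMap (p : Polynomial ℂ) : ratSlice hN (algebraMap _ (RatFunc ℂ) p) =
    Polynomial.eval₂RingHom ratC (coordT a b / coordY a b) p :=
  IsLocalization.lift_eq _ _

theorem ratSlice_const (c : ℂ) : ratSlice hN (algebraMap ℂ (RatFunc ℂ) c) = ratC c := by
  have : algebraMap ℂ (RatFunc ℂ) c = algebraMap (Polynomial ℂ) (RatFunc ℂ) (Polynomial.C c) := rfl
  rw [this, ratSlice_algebraMap]
  simp

theorem ratSlice_X : ratSlice hN RatFunc.X = coordT a b / coordY a b := by
  rw [← RatFunc.algebraMap_X, ratSlice_algebraMap]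
  simp

theorem homExpand_ratSlice (F : RatFunc ℂ) : homExpand hN (ratSlice hN F) = HahnSeries.C F := by
  have : (homExpand hN).comp (ratSlice hN) = HahnSeries.C := by
    apply IsLocalization.ringHom_ext (nonZeroDivisors (Polynomial ℂ))
    apply RingHom.ext
    intro p
    simp only [RingHom.comp_apply]
    rw [ratSlice_algebraMap, homExpand_eval₂]
  exact congrArg (fun φ : RatFunc ℂ →+* LaurentSeries (RatFunc ℂ) => φ F) this

theorem coordY_mul_derivT_ratSlice (F : RatFunc ℂ) :
    coordY a b * derivT a b (ratSlice hN F) = ratSlice hN (ratDeriv F) := by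
  refine eq_of_leibniz_ratFunc (ratSlice hN)
    (fun F => coordY a b * derivT a b (ratSlice hN F)) (fun F => ratSlice hN (ratDeriv F))
    (fun f g => by rw [map_add, map_add, mul_add])
    (fun f g => by rw [map_add, map_add]) ?_ ?_ ?_ ?_ F
  · intro x y
    simp only [map_mul, Derivation.leibniz, smul_eq_mul]
    ring
  · intro x y
    simp only [map_mul, Derivation.leibniz, smul_eq_mul, map_add]
  · intro c
    simp only [ratSlice_const, Derivation.map_ratC, ratDeriv_algebraMap,
      mul_zero, map_zero]
  · simp only [ratSlice_X, ratDeriv_X, map_one]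
    rw [Derivation.leibniz_div, derivT_coordT hN, derivT_coordY]
    have := coordY_ne_zero hN
    simp only [smul_eq_mul, mul_one, mul_zero, sub_zero]
    field_simp

theorem euler_ratSlice (F : RatFunc ℂ) :
    coordT a b * derivT a b (ratSlice hN F) + coordY a b * derivY a b (ratSlice hN F) = 0 := by
  refine eq_of_leibniz_ratFunc (ratSlice hN)
    (fun F => coordT a b * derivT a b (ratSlice hN F) + coordY a b * derivY a b (ratSlice hN F))
    (fun _ => 0) (fun f g => by rw [map_add, map_add, map_add]; ring) (fun f g => by simp)
    ?_ ?_ ?_ ?_ F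
  · intro x y
    simp only [map_mul, Derivation.leibniz, smul_eq_mul]
    ring
  · intro x y
    simp
  · intro c
    simp only [ratSlice_const, Derivation.map_ratC, mul_zero, add_zero]
  · simp only [ratSlice_X]
    rw [Derivation.leibniz_div, Derivation.leibniz_div, derivT_coordT hN, derivT_coordY,
      derivY_coordT, derivY_coordY hN]
    have := coordY_ne_zero hN
    simp only [smul_eq_mul, mul_one, mul_zero, sub_zero, zero_sub]
    field_simp
    ring

/-- The rational function `F(t/y) yᵈ`, homogeneous of degree `d`. -/
def homLift (d : ℤ) : RatFunc ℂ →ₗ[ℂ] RatFun2 where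
  toFun F := ratSlice hN F * coordY a b ^ d
  map_add' F G := by rw [map_add, add_mul]
  map_smul' c F := by
    rw [Algebra.smul_def, map_mul, ratSlice_const, RingHom.id_apply, Algebra.smul_def, mul_assoc]
    rfl

theorem homLift_apply (d : ℤ) (F : RatFunc ℂ) :
    homLift hN d F = ratSlice hN F * coordY a b ^ d := rfl

theorem homExpand_coordY_zpow (d : ℤ) :
    homExpand hN (coordY a b ^ d) = HahnSeries.single d 1 := by
  rw [map_zpow₀, homExpand_coordY]
  exact (RatFunc.single_zpow d).symm

theorem homComp_homLift_mul (n d : ℤ) (F : RatFunc ℂ) (g : RatFun2) :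
    homComp hN n (homLift hN d F * g) = F * homComp hN (n - d) g := by
  rw [homComp_apply, homLift_apply, map_mul, map_mul, homExpand_ratSlice, homExpand_coordY_zpow,
    HahnSeries.C_apply, HahnSeries.single_mul_single, HahnSeries.coeff_single_mul]
  simp [homComp_apply]

theorem homComp_homLift_self (d : ℤ) (F : RatFunc ℂ) : homComp hN d (homLift hN d F) = F := by
  have h := homComp_homLift_mul hN d d F 1
  rw [mul_one, sub_self, homComp_apply, homComp_apply, map_one] at h
  rw [homComp_apply, h]
  simp

theorem homLift_mul (d e : ℤ) (F G : RatFunc ℂ) :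
    homLift hN d F * homLift hN e G = homLift hN (d + e) (F * G) := by
  simp only [homLift_apply, map_mul, zpow_add₀ (coordY_ne_zero hN)]
  ring

theorem derivT_homLift (d : ℤ) (F : RatFunc ℂ) :
    derivT a b (homLift hN d F) = homLift hN (d - 1) (ratDeriv F) := by
  have hY := coordY_ne_zero hN
  have h := coordY_mul_derivT_ratSlice hN F
  rw [homLift_apply, homLift_apply, Derivation.leibniz, Derivation.leibniz_zpow, derivT_coordY,
    ← h, zpow_sub_one₀ hY]
  simp only [smul_eq_mul, mul_zero, smul_zero, zero_add]
  field_simp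

theorem derivY_homLift (d : ℤ) (F : RatFunc ℂ) :
    derivY a b (homLift hN d F) =
      homLift hN (d - 1) ((d : ℂ) • F - RatFunc.X * ratDeriv F) := by
  have hY := coordY_ne_zero hN
  have h := coordY_mul_derivT_ratSlice hN F
  have h2 := euler_ratSlice hN F
  have h3 : derivY a b (ratSlice hN F) =
      - (coordT a b * derivT a b (ratSlice hN F)) / coordY a b := by
    rw [eq_div_iff hY]
    linear_combination h2
  have hd : ratC (d : ℂ) = (d : RatFun2) := by simp
  rw [homLift_apply, homLift_apply, Derivation.leibniz, Derivation.leibniz_zpow, derivY_coordY hN,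
    zpow_sub_one₀ hY, Algebra.smul_def (d : ℂ) F, map_sub, map_mul, map_mul, ratSlice_const,
    ratSlice_X, ← h, h3, hd]
  simp only [smul_eq_mul, mul_one, zsmul_eq_mul]
  field_simp
  ring

end coordinates

/-! ### Differential operators and commutators with linear functions -/

theorem mulOp_apply (f g : RatFun2) : mulOp f g = f * g := rfl

theorem partialOp_apply (i : Fin 2) (f : RatFun2) : partialOp i f = ratPderiv i f := rfl

theorem mulOp_add (f g : RatFun2) : mulOp (f + g) = mulOp f + mulOp g := by
  ext h; simp [mulOp_apply, add_mul]

theorem mulOp_mul (f g : RatFun2) : mulOp (f * g) = mulOp f * mulOp g := by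
  ext h; simp [mulOp_apply, mul_assoc]

theorem ratC_mul_eq_smul (c : ℂ) (f : RatFun2) : ratC c * f = c • f :=
  (Algebra.smul_def c f).symm

theorem diffOp_eq_sum {P : MvPolynomial (Fin 2) RatFun2} {S : Finset (Fin 2 →₀ ℕ)}
    (h : P.support ⊆ S) :
    diffOp P = ∑ p ∈ S, mulOp (P.coeff p) * (partialOp 0 ^ p 0 * partialOp 1 ^ p 1) := by
  refine Finset.sum_subset h fun p _ hp => ?_
  rw [notMem_support_iff.mp hp]
  ext f
  simp [mulOp_apply]

theorem diffOp_add (P Q : MvPolynomial (Fin 2) RatFun2) :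
    diffOp (P + Q) = diffOp P + diffOp Q := by
  classical
  rw [diffOp_eq_sum (S := P.support ∪ Q.support) support_add,
    diffOp_eq_sum (P := P) (S := P.support ∪ Q.support) Finset.subset_union_left,
    diffOp_eq_sum (P := Q) (S := P.support ∪ Q.support) Finset.subset_union_right,
    ← Finset.sum_add_distrib]
  refine Finset.sum_congr rfl fun p _ => ?_
  rw [coeff_add, mulOp_add, add_mul]

theorem diffOp_monomial (p : Fin 2 →₀ ℕ) (c : RatFun2) :
    diffOp (monomial p c) = mulOp c * (partialOp 0 ^ p 0 * partialOp 1 ^ p 1) := by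
  classical
  rw [diffOp_eq_sum (S := {p}) support_monomial_subset, Finset.sum_singleton, coeff_monomial,
    if_pos rfl]

theorem diffOp_C (c : RatFun2) : diffOp (C c) = mulOp c := by
  have := diffOp_monomial 0 c
  simpa using this

theorem diffOp_C_mul_X (c : RatFun2) (i : Fin 2) : diffOp (C c * X i) = mulOp c * partialOp i := by
  rw [X, C_mul_monomial, mul_one, diffOp_monomial]
  fin_cases i <;> simp

theorem pow_mul_eq_of_commutator {A : Type*} [Ring A] {D M z : A} (h : D * M = M * D + z)
    (hz : Commute D z) (n : ℕ) : D ^ n * M = M * D ^ n + n * z * D ^ (n - 1) := by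
  induction n with
  | zero => simp
  | succ n ih =>
    rw [pow_succ', mul_assoc, ih, mul_add, ← mul_assoc, h]
    have : D * (n * z * D ^ (n - 1)) = n * z * D ^ n := by
      rcases n with _ | n
      · simp
      · rw [Nat.add_sub_cancel, pow_succ' D n, ← mul_assoc, ← mul_assoc, ← mul_assoc,
          (Nat.cast_commute (n + 1) D).symm.eq, mul_assoc _ D z, hz.eq, ← mul_assoc]
    rw [this, Nat.add_sub_cancel, add_mul, mul_assoc M]
    push_cast
    rw [add_mul, add_mul, one_mul, add_assoc, add_comm (z * D ^ n)]

/-- The linear function with constant gradient `ζ`. -/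
def linFun (ζ : Fin 2 → ℂ) : RatFun2 := ratC (ζ 0) * ratX 0 + ratC (ζ 1) * ratX 1

theorem partialOp_mul_linFun (ζ : Fin 2 → ℂ) (i : Fin 2) :
    partialOp i * mulOp (linFun ζ) = mulOp (linFun ζ) * partialOp i + ζ i • 1 := by
  ext f
  simp only [Module.End.mul_apply, mulOp_apply, partialOp_apply, LinearMap.add_apply,
    LinearMap.smul_apply, Module.End.one_apply]
  have : ratPderiv i (linFun ζ) = ratC (ζ i) := by
    fin_cases i
    · exact ratPderiv_zero_linear _ _
    · exact ratPderiv_one_linear _ _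
  rw [Derivation.leibniz, this, smul_eq_mul, smul_eq_mul, mul_comm f, ratC_mul_eq_smul]

/-- Exact on full symbols, without lower-order corrections, because the gradient of a linear
function is constant. Iterated commutators thus reduce to iterated `dirDeriv`. -/
theorem diffOp_mul_linFun (ζ : Fin 2 → ℂ) (P : MvPolynomial (Fin 2) RatFun2) :
    diffOp P * mulOp (linFun ζ) - mulOp (linFun ζ) * diffOp P =
      diffOp (dirDeriv (fun i => ratC (ζ i)) P) := by
  induction P using MvPolynomial.induction_on' with
  | add P Q hP hQ =>
    rw [map_add, diffOp_add, diffOp_add, ← hP, ← hQ, add_mul, mul_add]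
    abel
  | monomial p c =>
    have h0 := pow_mul_eq_of_commutator (partialOp_mul_linFun ζ 0)
      ((Commute.one_right _).smul_right _) (p 0)
    have h1 := pow_mul_eq_of_commutator (partialOp_mul_linFun ζ 1)
      ((Commute.one_right _).smul_right _) (p 1)
    have hc : mulOp c * mulOp (linFun ζ) = mulOp (linFun ζ) * mulOp c := by
      rw [← mulOp_mul, ← mulOp_mul, mul_comm]
    have e0 : diffOp (C (ratC (ζ 0)) * monomial (p - Finsupp.single 0 1) (c * p 0)) =
        mulOp c * ((p 0 * ζ 0 • 1 * partialOp 0 ^ (p 0 - 1)) * partialOp 1 ^ p 1) := by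
      rw [C_mul_monomial, diffOp_monomial]
      ext f
      simp [mulOp_apply, Module.End.mul_apply, ← ratC_mul_eq_smul]
      ring
    have e1 : diffOp (C (ratC (ζ 1)) * monomial (p - Finsupp.single 1 1) (c * p 1)) =
        mulOp c * (partialOp 0 ^ p 0 * (p 1 * ζ 1 • 1 * partialOp 1 ^ (p 1 - 1))) := by
      rw [C_mul_monomial, diffOp_monomial]
      ext f
      have : ∀ (n : ℕ) (g : RatFun2), (n : Module.End ℂ RatFun2) g = (n : ℂ) • g := by
        intro n g
        rw [Module.End.natCast_apply, Nat.cast_smul_eq_nsmul]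
      simp only [Module.End.mul_apply, mulOp_apply, LinearMap.smul_apply, Module.End.one_apply,
        this, map_smul]
      simp [← ratC_mul_eq_smul]
      ring
    rw [dirDeriv_apply, pderiv_monomial, pderiv_monomial, diffOp_add, e0, e1, diffOp_monomial,
      mul_assoc, mul_assoc (partialOp 0 ^ p 0), h1, mul_add, mul_add, ← mul_assoc (partialOp 0 ^ p 0),
      h0, ← mul_assoc (mulOp (linFun ζ)), ← hc]
    noncomm_ring

/-- An iterated commutator identity: if `L` commutes with `Q 0` and `Q (n+1) = [Q n, ℓ]`, where
`[L, ℓ] = -2 D` and `[D, ℓ]` is central, then `[L, Q (n+1)] = 2 (n+1) [D, Q n]`. -/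
theorem commutator_iterate {A : Type*} [Ring A] {L D ℓ z : A} {Q : ℕ → A}
    (hLℓ : L * ℓ - ℓ * L = -(2 * D)) (hDℓ : D * ℓ - ℓ * D = z) (hz : ∀ n, z * Q n = Q n * z)
    (hQ : ∀ n, Q (n + 1) = Q n * ℓ - ℓ * Q n) (h0 : L * Q 0 = Q 0 * L) (n : ℕ) :
    L * Q (n + 1) - Q (n + 1) * L = 2 * (n + 1) * (D * Q n - Q n * D) := by
  -- Jacobi's identity together with [L, ℓ] = -2 D.
  have step : ∀ n, L * Q (n + 1) - Q (n + 1) * L =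
      (L * Q n - Q n * L) * ℓ - ℓ * (L * Q n - Q n * L) + 2 * (D * Q n - Q n * D) := by
    intro n
    have e1 : L * ℓ = ℓ * L - 2 * D := by rw [sub_eq_iff_eq_add] at hLℓ; rw [hLℓ]; abel
    calc L * Q (n + 1) - Q (n + 1) * L
        = L * Q n * ℓ - (L * ℓ) * Q n - Q n * (ℓ * L) + ℓ * Q n * L := by
          rw [hQ]; noncomm_ring
      _ = L * Q n * ℓ - (ℓ * L - 2 * D) * Q n - Q n * (L * ℓ + 2 * D) + ℓ * Q n * L := by
          rw [e1]; noncomm_ring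
      _ = _ := by noncomm_ring
  induction n with
  | zero => rw [step, h0]; simp
  | succ n ih =>
    rw [step, ih]
    have e2 : D * ℓ = ℓ * D + z := by rw [← hDℓ]; abel
    -- Jacobi's identity again: the central term [D, ℓ] drops out.
    have e3 : (D * Q n - Q n * D) * ℓ - ℓ * (D * Q n - Q n * D) =
        D * Q (n + 1) - Q (n + 1) * D := by
      calc (D * Q n - Q n * D) * ℓ - ℓ * (D * Q n - Q n * D)
          = D * Q n * ℓ - Q n * (D * ℓ) - ℓ * D * Q n + ℓ * Q n * D + (z * Q n - Q n * z)
              - (z * Q n - Q n * z) := by noncomm_ring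
        _ = D * Q n * ℓ - Q n * (D * ℓ) - ℓ * D * Q n + ℓ * Q n * D
              - (z * Q n - Q n * z) := by rw [hz n]; noncomm_ring
        _ = D * Q (n + 1) - Q (n + 1) * D := by
            rw [hQ, e2, mul_sub, ← mul_assoc D ℓ, e2]; noncomm_ring
    have hc : ℓ * (2 * ((n : A) + 1)) = 2 * ((n : A) + 1) * ℓ := by
      have : (2 * ((n : A) + 1)) = ((2 * (n + 1) : ℕ) : A) := by push_cast; rfl
      rw [this]
      exact (Nat.cast_commute _ _).symm.eq
    rw [mul_assoc (2 * ((n : A) + 1)), ← mul_assoc ℓ, hc, mul_assoc _ ℓ, ← mul_sub, e3]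
    push_cast
    noncomm_ring

/-! ### Homogeneous operators and the Schrödinger operator in adapted coordinates -/

section coordinates

variable {a b : ℂ} (hN : a ^ 2 + b ^ 2 ≠ 0)

/-- `Q` is a homogeneous operator of degree `e`, acting by `q n` on functions homogeneous of
degree `n`. -/
structure IsHomOp (Q : Module.End ℂ RatFun2) (e : ℤ) (q : ℤ → RatFunc ℂ →ₗ[ℂ] RatFunc ℂ) :
    Prop where
  -- Both conditions are needed: `P` is not assumed homogeneous, so a homogeneous operator meets it
  -- on the right applied to pure lifts and on the left applied to arbitrary functions.
  comp : ∀ n f, homComp hN (n + e) (Q f) = q n (homComp hN n f)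
  lift : ∀ n F, Q (homLift hN n F) = homLift hN (n + e) (q n F)

variable {hN}

theorem IsHomOp.add {Q₁ Q₂ : Module.End ℂ RatFun2} {e : ℤ} {q₁ q₂ : ℤ → RatFunc ℂ →ₗ[ℂ] RatFunc ℂ}
    (h₁ : IsHomOp hN Q₁ e q₁) (h₂ : IsHomOp hN Q₂ e q₂) :
    IsHomOp hN (Q₁ + Q₂) e fun n => q₁ n + q₂ n where
  comp n f := by simp [h₁.comp, h₂.comp]
  lift n F := by simp [h₁.lift, h₂.lift]

theorem IsHomOp.neg {Q : Module.End ℂ RatFun2} {e : ℤ} {q : ℤ → RatFunc ℂ →ₗ[ℂ] RatFunc ℂ}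
    (h : IsHomOp hN Q e q) : IsHomOp hN (-Q) e fun n => -q n where
  comp n f := by simp [h.comp]
  lift n F := by simp [h.lift]

theorem IsHomOp.smul {Q : Module.End ℂ RatFun2} {e : ℤ} {q : ℤ → RatFunc ℂ →ₗ[ℂ] RatFunc ℂ}
    (h : IsHomOp hN Q e q) (c : ℂ) : IsHomOp hN (c • Q) e fun n => c • q n where
  comp n f := by rw [LinearMap.smul_apply, map_smul, h.comp]; rfl
  lift n F := by rw [LinearMap.smul_apply, h.lift, ← map_smul]; rfl

theorem IsHomOp.mul {Q₁ Q₂ : Module.End ℂ RatFun2} {e₁ e₂ : ℤ}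
    {q₁ q₂ : ℤ → RatFunc ℂ →ₗ[ℂ] RatFunc ℂ}
    (h₁ : IsHomOp hN Q₁ e₁ q₁) (h₂ : IsHomOp hN Q₂ e₂ q₂) :
    IsHomOp hN (Q₁ * Q₂) (e₂ + e₁) fun n => q₁ (n + e₂) ∘ₗ q₂ n where
  comp n f := by rw [← add_assoc, Module.End.mul_apply, h₁.comp, h₂.comp]; rfl
  lift n F := by rw [Module.End.mul_apply, h₂.lift, h₁.lift, add_assoc]; rfl

/-- The action of `derivY` on functions homogeneous of degree `n`. -/
def sliceY (n : ℤ) : RatFunc ℂ →ₗ[ℂ] RatFunc ℂ :=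
  (n : ℂ) • LinearMap.id - LinearMap.mulLeft ℂ (RatFunc.X : RatFunc ℂ) ∘ₗ ratDeriv.toLinearMap

theorem sliceY_apply (n : ℤ) (F : RatFunc ℂ) :
    sliceY n F = (n : ℂ) • F - RatFunc.X * ratDeriv F := rfl

variable (hN)

theorem isHomOp_derivT :
    IsHomOp hN (derivT a b).toLinearMap (-1) fun _ => ratDeriv.toLinearMap where
  comp n f := by
    have := homComp_derivT hN (n + -1) f
    rwa [neg_add_cancel_right] at this
  lift n F := derivT_homLift hN n F

theorem isHomOp_derivY : IsHomOp hN (derivY a b).toLinearMap (-1) sliceY where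
  comp n f := by
    have := homComp_derivY hN (n + -1) f
    rwa [neg_add_cancel_right] at this
  lift n F := derivY_homLift hN n F

theorem isHomOp_mulOp (e : ℤ) (V : RatFunc ℂ) :
    IsHomOp hN (mulOp (homLift hN e V)) e fun _ => LinearMap.mulLeft ℂ V where
  comp n f := by
    rw [mulOp_apply, homComp_homLift_mul, add_sub_cancel_right]; rfl
  lift n F := by rw [mulOp_apply, homLift_mul, add_comm]; rfl

/-- The derivative in the direction with coordinates `(z₀, 1)`. -/
def flowOp (a b z₀ : ℂ) : Module.End ℂ RatFun2 :=
  z₀ • (derivT a b).toLinearMap + (derivY a b).toLinearMap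

/-- The action of `flowOp` on functions homogeneous of degree `n`. -/
def sliceFlow (z₀ : ℂ) (n : ℤ) : RatFunc ℂ →ₗ[ℂ] RatFunc ℂ :=
  z₀ • ratDeriv.toLinearMap + sliceY n

theorem sliceFlow_apply (z₀ : ℂ) (n : ℤ) (F : RatFunc ℂ) :
    sliceFlow z₀ n F = z₀ • ratDeriv F + ((n : ℂ) • F - RatFunc.X * ratDeriv F) := rfl

theorem isHomOp_flowOp (z₀ : ℂ) : IsHomOp hN (flowOp a b z₀) (-1) (sliceFlow z₀) :=
  ((isHomOp_derivT hN).smul z₀).add (isHomOp_derivY hN)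

/-- A Schrödinger operator in the coordinates `coordT`, `coordY`. -/
def scaledOp (a b : ℂ) (U : RatFun2) : Module.End ℂ RatFun2 :=
  -((derivT a b).toLinearMap * (derivT a b).toLinearMap +
    (derivY a b).toLinearMap * (derivY a b).toLinearMap) + mulOp U

/-- The action of `scaledOp` on functions homogeneous of degree `n`. -/
def sliceOp (V : RatFunc ℂ) (n : ℤ) : RatFunc ℂ →ₗ[ℂ] RatFunc ℂ :=
  -(ratDeriv.toLinearMap ∘ₗ ratDeriv.toLinearMap + sliceY (n + -1) ∘ₗ sliceY n) +
    LinearMap.mulLeft ℂ V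

theorem sliceOp_apply (V : RatFunc ℂ) (n : ℤ) (F : RatFunc ℂ) :
    sliceOp V n F = -(ratDeriv (ratDeriv F) + sliceY (n + -1) (sliceY n F)) + V * F := rfl

theorem isHomOp_scaledOp (V : RatFunc ℂ) :
    IsHomOp hN (scaledOp a b (homLift hN (-2) V)) (-2) (sliceOp V) :=
  (((isHomOp_derivT hN).mul (isHomOp_derivT hN)).add
    ((isHomOp_derivY hN).mul (isHomOp_derivY hN))).neg.add (isHomOp_mulOp hN (-2) V)

/-- The change of coordinates is a similarity, so the Laplacian only acquires the factor a² + b². -/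
theorem schrodinger_eq (hN : a ^ 2 + b ^ 2 ≠ 0)
    (H : Finset (EuclideanSpace ℝ (Fin 2))) (c : EuclideanSpace ℝ (Fin 2) → ℂ) :
    schrodinger H c = (a ^ 2 + b ^ 2) •
      scaledOp a b (ratC (a ^ 2 + b ^ 2)⁻¹ * potential H c) := by
  ext f
  simp only [schrodinger, scaledOp, LinearMap.add_apply, LinearMap.neg_apply, LinearMap.smul_apply,
    Module.End.mul_apply, mulOp_apply, pow_two, partialOp_apply, ← ratC_mul_eq_smul]
  change -(ratPderiv 0 (ratPderiv 0 f) + ratPderiv 1 (ratPderiv 1 f)) + _ =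
    ratC _ * (-(derivT a b (derivT a b f) + derivY a b (derivY a b f)) + _)
  rw [ratPderiv_zero_eq hN (ratPderiv 0 f), ratPderiv_one_eq hN (ratPderiv 1 f),
    ratPderiv_zero_eq hN f, ratPderiv_one_eq hN f]
  simp only [map_add (derivT a b), map_add (derivY a b), Derivation.map_ratC_mul]
  have h := congrArg ratC
    (show (a * a + b * b) * (a * a + b * b)⁻¹ = 1 from mul_inv_cancel₀ (by simpa [pow_two] using hN))
  simp only [map_add, map_mul ratC, map_one, map_neg] at h ⊢
  linear_combination (- potential H c * f) * h

/-- This fixes the choice of ζ: it points along z = z₀, and its linear function has (t, y)-gradient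
(z₀, 1), the direction of `flowOp`. -/
theorem linFun_eq (z₀ : ℂ) : linFun ![z₀ * a - b, z₀ * b + a] =
    ratC z₀ * coordT a b + coordY a b := by
  simp only [linFun, coordT, coordY, Matrix.cons_val_zero, Matrix.cons_val_one, map_add, map_sub,
    map_mul, map_neg, Matrix.cons_val_fin_one]
  ring

theorem derivT_linFun (hN : a ^ 2 + b ^ 2 ≠ 0) (z₀ : ℂ) :
    derivT a b (linFun ![z₀ * a - b, z₀ * b + a]) = ratC z₀ := by
  rw [linFun_eq, map_add, Derivation.map_ratC_mul, derivT_coordT hN, derivT_coordY]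
  ring

theorem derivY_linFun (hN : a ^ 2 + b ^ 2 ≠ 0) (z₀ : ℂ) :
    derivY a b (linFun ![z₀ * a - b, z₀ * b + a]) = 1 := by
  rw [linFun_eq, map_add, Derivation.map_ratC_mul, derivY_coordY hN, derivY_coordT]
  ring

theorem scaledOp_commutator (hN : a ^ 2 + b ^ 2 ≠ 0) (U : RatFun2) (z₀ : ℂ) :
    scaledOp a b U * mulOp (linFun ![z₀ * a - b, z₀ * b + a]) -
      mulOp (linFun ![z₀ * a - b, z₀ * b + a]) * scaledOp a b U = -(2 * flowOp a b z₀) := by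
  ext f
  have e2 : ∀ g : RatFun2, (2 : Module.End ℂ RatFun2) g = 2 * g := by
    intro g
    rw [show (2 : Module.End ℂ RatFun2) = 1 + 1 by norm_num, LinearMap.add_apply]
    simp [two_mul]
  simp only [scaledOp, flowOp, LinearMap.add_apply, LinearMap.neg_apply, LinearMap.smul_apply,
    LinearMap.sub_apply, Module.End.mul_apply, mulOp_apply, e2, ← ratC_mul_eq_smul]
  simp only [Derivation.coeFn_coe, Derivation.leibniz,
    map_add (derivT a b), map_add (derivY a b), smul_eq_mul, derivT_linFun hN, derivY_linFun hN,
    Derivation.map_ratC, Derivation.map_one_eq_zero]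
  ring

theorem flowOp_commutator (hN : a ^ 2 + b ^ 2 ≠ 0) (z₀ : ℂ) :
    flowOp a b z₀ * mulOp (linFun ![z₀ * a - b, z₀ * b + a]) -
      mulOp (linFun ![z₀ * a - b, z₀ * b + a]) * flowOp a b z₀ = (z₀ ^ 2 + 1) • 1 := by
  ext f
  simp only [flowOp, LinearMap.add_apply, LinearMap.smul_apply,
    LinearMap.sub_apply, Module.End.mul_apply, mulOp_apply, ← ratC_mul_eq_smul,
    Module.End.one_apply]
  simp only [Derivation.coeFn_coe, Derivation.leibniz,
    smul_eq_mul, derivT_linFun hN, derivY_linFun hN, map_add, map_one, map_pow]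
  ring

end coordinates

/-! ### Regular functions at z₀ and the flow equation -/

/-- The rational functions in one variable that are regular at `z₀`. -/
def regularAt (z₀ : ℂ) : Subalgebra ℂ (RatFunc ℂ) where
  carrier := {F | ∃ p q : Polynomial ℂ, q.eval z₀ ≠ 0 ∧
    F * algebraMap _ (RatFunc ℂ) q = algebraMap _ (RatFunc ℂ) p}
  mul_mem' := by
    rintro F G ⟨p, q, hq, h⟩ ⟨p', q', hq', h'⟩
    refine ⟨p * p', q * q', by simp [hq, hq'], ?_⟩
    rw [map_mul, map_mul, ← h, ← h']; ring
  add_mem' := by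
    rintro F G ⟨p, q, hq, h⟩ ⟨p', q', hq', h'⟩
    refine ⟨p * q' + p' * q, q * q', by simp [hq, hq'], ?_⟩
    rw [map_mul, map_add, map_mul, map_mul, ← h, ← h']; ring
  algebraMap_mem' c := ⟨Polynomial.C c, 1, by simp, by rw [map_one, mul_one]; rfl⟩

theorem algebraMap_mem_regularAt (z₀ : ℂ) (p : Polynomial ℂ) :
    algebraMap _ (RatFunc ℂ) p ∈ regularAt z₀ := ⟨p, 1, by simp, by simp⟩

theorem X_mem_regularAt (z₀ : ℂ) : (RatFunc.X : RatFunc ℂ) ∈ regularAt z₀ := by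
  rw [← RatFunc.algebraMap_X]; exact algebraMap_mem_regularAt z₀ _

theorem inv_mem_regularAt {z₀ : ℂ} {q : Polynomial ℂ} (hq : q.eval z₀ ≠ 0) :
    (algebraMap _ (RatFunc ℂ) q)⁻¹ ∈ regularAt z₀ := by
  refine ⟨1, q, hq, ?_⟩
  rw [inv_mul_cancel₀, map_one]
  refine (map_ne_zero_iff _ (RatFunc.algebraMap_injective ℂ)).mpr ?_
  rintro rfl
  simp at hq

/-- A rational function is regular outside the zeros of its denominator. -/
theorem exists_forall_mem_regularAt (F : RatFunc ℂ) :
    ∃ q : Polynomial ℂ, q ≠ 0 ∧ ∀ z₀, q.eval z₀ ≠ 0 → F ∈ regularAt z₀ := by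
  refine ⟨F.denom, F.denom_ne_zero, fun z₀ hz => ⟨F.num, F.denom, hz, ?_⟩⟩
  have h := F.num_div_denom
  rw [div_eq_iff ((map_ne_zero_iff _ (RatFunc.algebraMap_injective ℂ)).mpr F.denom_ne_zero)] at h
  exact h.symm

theorem ratDeriv_algebraMap_poly (p : Polynomial ℂ) : ratDeriv (algebraMap _ (RatFunc ℂ) p) =
    algebraMap _ (RatFunc ℂ) (Polynomial.derivative p) := by
  induction p using Polynomial.induction_on with
  | C c =>
    have := ratDeriv_algebraMap c
    rw [Polynomial.derivative_C, map_zero, ← this]; rfl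
  | add p q hp hq => simp only [map_add, hp, hq]
  | monomial n c h =>
    rw [pow_succ, ← mul_assoc, map_mul, Derivation.leibniz, h, RatFunc.algebraMap_X, ratDeriv_X,
      Polynomial.derivative_mul (g := Polynomial.X), Polynomial.derivative_X, map_add, mul_one,
      map_mul _ _ Polynomial.X, RatFunc.algebraMap_X, smul_eq_mul, smul_eq_mul]
    ring

theorem ratDeriv_mem_regularAt {z₀ : ℂ} {F : RatFunc ℂ} (hF : F ∈ regularAt z₀) :
    ratDeriv F ∈ regularAt z₀ := by
  obtain ⟨p, q, hq, h⟩ := hF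
  have hd := congrArg ratDeriv h
  rw [Derivation.leibniz, ratDeriv_algebraMap_poly, ratDeriv_algebraMap_poly, smul_eq_mul,
    smul_eq_mul] at hd
  refine ⟨Polynomial.derivative p * q - p * Polynomial.derivative q, q * q, by simp [hq], ?_⟩
  rw [map_sub, map_mul, map_mul, map_mul, ← h, ← hd]
  ring

theorem sliceY_mem_regularAt {z₀ : ℂ} {F : RatFunc ℂ} (hF : F ∈ regularAt z₀) (n : ℤ) :
    sliceY n F ∈ regularAt z₀ :=
  sub_mem (Subalgebra.smul_mem _ hF _) (mul_mem (X_mem_regularAt z₀) (ratDeriv_mem_regularAt hF))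

theorem sliceOp_mem_regularAt {z₀ : ℂ} {V F : RatFunc ℂ} (hV : V ∈ regularAt z₀)
    (hF : F ∈ regularAt z₀) (n : ℤ) : sliceOp V n F ∈ regularAt z₀ :=
  add_mem (neg_mem (add_mem (ratDeriv_mem_regularAt (ratDeriv_mem_regularAt hF))
    (sliceY_mem_regularAt (sliceY_mem_regularAt hF _) _))) (mul_mem hV hF)

theorem sliceFlow_eq (z₀ : ℂ) (n : ℤ) (F : RatFunc ℂ) : sliceFlow z₀ n F =
    (algebraMap ℂ (RatFunc ℂ) z₀ - RatFunc.X) * ratDeriv F + (n : RatFunc ℂ) * F := by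
  rw [sliceFlow_apply, Algebra.smul_def, Algebra.smul_def, map_intCast]
  ring

/-- A regular function annihilated by `sliceFlow z₀ n` with `n < 0` is divisible by any power of
`z - z₀`. -/
theorem exists_eq_pow_mul_of_sliceFlow_eq_zero {z₀ : ℂ} (k : ℕ) : ∀ {n : ℤ}, n < 0 →
    ∀ {F : RatFunc ℂ}, F ∈ regularAt z₀ → sliceFlow z₀ n F = 0 →
    ∃ G ∈ regularAt z₀, F = (RatFunc.X - algebraMap ℂ (RatFunc ℂ) z₀) ^ k * G := by
  induction k with
  | zero => exact fun {n} _ {F} hF _ => ⟨F, hF, by simp⟩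
  | succ k ih =>
    intro n hn F hF h
    have hn0 : (n : RatFunc ℂ) ≠ 0 := by exact_mod_cast hn.ne
    have hF1 : ((n : ℂ)⁻¹ • ratDeriv F) ∈ regularAt z₀ :=
      Subalgebra.smul_mem _ (ratDeriv_mem_regularAt hF) _
    -- The equation itself exhibits a factor z - z₀. The cofactor F' / n solves the same equation in
    -- degree n - 1, so the extraction can be repeated.
    have e1 : F = (RatFunc.X - algebraMap ℂ (RatFunc ℂ) z₀) * ((n : ℂ)⁻¹ • ratDeriv F) := by
      rw [sliceFlow_eq] at h
      rw [Algebra.smul_def, map_inv₀, map_intCast]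
      field_simp
      linear_combination h
    have e2 : sliceFlow z₀ (n - 1) ((n : ℂ)⁻¹ • ratDeriv F) = 0 := by
      have h3 := congrArg ratDeriv e1
      rw [Derivation.leibniz, map_sub, ratDeriv_X, ratDeriv_algebraMap, smul_eq_mul, smul_eq_mul]
        at h3
      have h4 : ratDeriv F = (n : RatFunc ℂ) * ((n : ℂ)⁻¹ • ratDeriv F) := by
        rw [Algebra.smul_def, map_inv₀, map_intCast]
        field_simp
      rw [sliceFlow_eq]
      push_cast
      linear_combination h3 - h4
    obtain ⟨G, hG, h5⟩ := ih (by omega) hF1 e2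
    exact ⟨G, hG, by rw [e1, h5, pow_succ]; ring⟩

/-- Formally the solutions are the multiples of (z - z₀)ⁿ, singular for n < 0. Algebraically, a
regular solution would vanish to arbitrary order at z₀, exceeding the degree of its numerator. -/
theorem eq_zero_of_sliceFlow_eq_zero {z₀ : ℂ} {n : ℤ} (hn : n < 0) {F : RatFunc ℂ}
    (hF : F ∈ regularAt z₀) (h : sliceFlow z₀ n F = 0) : F = 0 := by
  obtain ⟨p, q, hq, hpq⟩ := hF
  obtain ⟨G, ⟨p', q', hq', hpq'⟩, hG⟩ :=
    exists_eq_pow_mul_of_sliceFlow_eq_zero (p.natDegree + 1) hn ⟨p, q, hq, hpq⟩ h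
  have e : p * q' = (Polynomial.X - Polynomial.C z₀) ^ (p.natDegree + 1) * (p' * q) := by
    apply RatFunc.algebraMap_injective ℂ
    have : algebraMap (Polynomial ℂ) (RatFunc ℂ) (Polynomial.C z₀) =
      algebraMap ℂ (RatFunc ℂ) z₀ := rfl
    rw [map_mul, map_mul, map_mul, map_pow, map_sub, RatFunc.algebraMap_X, this, ← hpq, ← hpq',
      hG]
    ring
  have hcop : IsCoprime ((Polynomial.X - Polynomial.C z₀) ^ (p.natDegree + 1)) q' := by
    refine IsCoprime.pow_left ?_
    refine (Polynomial.irreducible_X_sub_C z₀).coprime_iff_not_dvd.mpr ?_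
    rwa [Polynomial.dvd_iff_isRoot]
  have hp : p = 0 := by
    refine Polynomial.eq_zero_of_dvd_of_natDegree_lt (hcop.dvd_of_dvd_mul_right ⟨_, e⟩) ?_
    simp
  rw [hp, map_zero] at hpq
  refine (mul_eq_zero.mp hpq).resolve_right ?_
  refine (map_ne_zero_iff _ (RatFunc.algebraMap_injective ℂ)).mpr ?_
  rintro rfl
  simp at hq

/-- If a vector field transversal to the direction `(z₀, 1)` sends `F` into the image of
`sliceFlow z₀ n`, then `F` is in the image of `sliceFlow z₀ (n + 1)`. -/
theorem exists_sliceFlow_eq {z₀ r s : ℂ} (hrs : r ≠ z₀ * s) {n : ℤ} (hn : n + 1 ≠ 0)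
    {F G : RatFunc ℂ} (hF : F ∈ regularAt z₀) (hG : G ∈ regularAt z₀)
    (h : r • ratDeriv F + s • sliceY n F = sliceFlow z₀ n G) :
    ∃ F' ∈ regularAt z₀, sliceFlow z₀ (n + 1) F' = F := by
  have hrs' : algebraMap ℂ (RatFunc ℂ) r - algebraMap ℂ (RatFunc ℂ) z₀ *
      algebraMap ℂ (RatFunc ℂ) s ≠ 0 := by
    rw [← map_mul, ← map_sub]
    exact (map_ne_zero _).mpr (sub_ne_zero.mpr hrs)
  have hn' : (n : RatFunc ℂ) + 1 ≠ 0 := by exact_mod_cast hn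
  have hn'' : (n : ℂ) + 1 ≠ 0 := by exact_mod_cast hn
  -- Since ∂_y = D - z₀ ∂_t, the hypothesis becomes (r - z₀ s) ∂_t F = D (G - s F).
  obtain ⟨G', hG', e⟩ : ∃ G' ∈ regularAt z₀, ratDeriv F = sliceFlow z₀ n G' := by
    refine ⟨(r - z₀ * s)⁻¹ • (G - s • F), Subalgebra.smul_mem _
      (sub_mem hG (Subalgebra.smul_mem _ hF _)) _, ?_⟩
    rw [map_smul, map_sub, map_smul, ← h, sliceFlow_apply, sliceY_apply]
    simp only [Algebra.smul_def, map_inv₀, map_sub, map_mul]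
    field_simp
    ring
  -- The primitive comes from Euler's identity. As D (t - z₀ y) = 0 and D y = 1, D ((t - z₀ y) G' +
  -- y F) = t ∂_t F + y ∂_y F + F = (n + 1) F.
  refine ⟨((n : ℂ) + 1)⁻¹ • ((RatFunc.X - algebraMap ℂ (RatFunc ℂ) z₀) * G' + F),
    Subalgebra.smul_mem _ (add_mem (mul_mem (sub_mem (X_mem_regularAt z₀)
      (Subalgebra.algebraMap_mem _ _)) hG') hF) _, ?_⟩
  rw [sliceFlow_eq] at e
  rw [map_smul, sliceFlow_eq, map_add, Derivation.leibniz, map_sub, ratDeriv_X,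
    ratDeriv_algebraMap, smul_eq_mul, smul_eq_mul, e, Algebra.smul_def, map_inv₀, map_add,
    map_intCast, map_one]
  push_cast
  field_simp
  ring

/-! ### Homogeneous pieces of the commuting operator -/

section coordinates

variable {a b : ℂ} (hN : a ^ 2 + b ^ 2 ≠ 0)

theorem exists_partialOp_homLift {z₀ : ℂ} (i : Fin 2) (n : ℤ) {F : RatFunc ℂ}
    (hF : F ∈ regularAt z₀) :
    ∃ G ∈ regularAt z₀, partialOp i (homLift hN n F) = homLift hN (n - 1) G := by
  have key : ∀ r s : ℂ, ∃ G ∈ regularAt z₀, ratC r * derivT a b (homLift hN n F) +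
      ratC s * derivY a b (homLift hN n F) = homLift hN (n - 1) G := by
    intro r s
    refine ⟨r • ratDeriv F + s • sliceY n F, add_mem
      (Subalgebra.smul_mem _ (ratDeriv_mem_regularAt hF) _)
      (Subalgebra.smul_mem _ (sliceY_mem_regularAt hF n) _), ?_⟩
    rw [derivT_homLift, derivY_homLift, ratC_mul_eq_smul, ratC_mul_eq_smul, map_add, map_smul,
      map_smul, sliceY_apply]
  rw [partialOp_apply]
  fin_cases i
  · simp only [Fin.zero_eta]
    rw [ratPderiv_zero_eq hN]
    exact key _ _
  · simp only [Fin.mk_one]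
    rw [ratPderiv_one_eq hN]
    exact key _ _

theorem exists_partialOp_pow_homLift {z₀ : ℂ} (i : Fin 2) (k : ℕ) (n : ℤ) {F : RatFunc ℂ}
    (hF : F ∈ regularAt z₀) :
    ∃ G ∈ regularAt z₀, (partialOp i ^ k) (homLift hN n F) = homLift hN (n - k) G := by
  induction k with
  | zero => exact ⟨F, hF, by simp⟩
  | succ k ih =>
    obtain ⟨G, hG, h⟩ := ih
    obtain ⟨G', hG', h'⟩ := exists_partialOp_homLift hN i (n - k) hG
    refine ⟨G', hG', ?_⟩
    rw [pow_succ', Module.End.mul_apply, h, h']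
    push_cast
    rw [sub_sub]

/-- The symbol `G` has regular component of degree `e`, where `∂ᵖ` has degree `-|p|`. -/
def RegularSymbol (z₀ : ℂ) (e : ℤ) (G : MvPolynomial (Fin 2) RatFun2) : Prop :=
  ∀ p : Fin 2 →₀ ℕ, homComp hN ((p 0 : ℤ) + p 1 + e) (coeff p G) ∈ regularAt z₀

variable {hN}

theorem RegularSymbol.diffOp_mem {z₀ : ℂ} {e : ℤ} {G : MvPolynomial (Fin 2) RatFun2}
    (hG : RegularSymbol hN z₀ e G) (n : ℤ) {F : RatFunc ℂ} (hF : F ∈ regularAt z₀) :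
    homComp hN (n + e) (diffOp G (homLift hN n F)) ∈ regularAt z₀ := by
  rw [diffOp, LinearMap.sum_apply, map_sum]
  refine sum_mem fun p _ => ?_
  obtain ⟨F₁, hF₁, h₁⟩ := exists_partialOp_pow_homLift hN 1 (p 1) n hF
  obtain ⟨F₂, hF₂, h₂⟩ := exists_partialOp_pow_homLift hN 0 (p 0) (n - p 1) hF₁
  rw [Module.End.mul_apply, Module.End.mul_apply, h₁, h₂, mulOp_apply, mul_comm,
    homComp_homLift_mul]
  refine mul_mem hF₂ ?_
  have : n + e - (n - (p 1 : ℤ) - p 0) = p 0 + p 1 + e := by ring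
  rw [this]
  exact hG p

theorem RegularSymbol.dirDeriv {z₀ : ℂ} {e : ℤ} {G : MvPolynomial (Fin 2) RatFun2}
    (hG : RegularSymbol hN z₀ e G) (ζ : Fin 2 → ℂ) :
    RegularSymbol hN z₀ (e + 1) (_root_.dirDeriv (fun i => ratC (ζ i)) G) := by
  intro p
  have key : ∀ (i : Fin 2) (d : ℤ), d = (p 0 : ℤ) + p 1 + (e + 1) →
      homComp hN d (ratC (ζ i) * coeff p (pderiv i G)) ∈ regularAt z₀ := by
    intro i d hd
    have h := hG (p + Finsupp.single i 1)
    have hd' : ((p + Finsupp.single i 1 : Fin 2 →₀ ℕ) 0 : ℤ) +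
        (p + Finsupp.single i 1 : Fin 2 →₀ ℕ) 1 + e = d := by
      fin_cases i <;> simp [hd] <;> ring
    rw [hd'] at h
    have hc : ratC (ζ i) * coeff p (pderiv i G) =
        (ζ i * ((p i : ℂ) + 1)) • coeff (p + Finsupp.single i 1) G := by
      rw [coeff_pderiv, ← ratC_mul_eq_smul, map_mul, map_add, map_natCast, map_one]
      ring
    rw [hc, map_smul]
    exact Subalgebra.smul_mem _ h _
  rw [dirDeriv_apply, coeff_add, coeff_C_mul, coeff_C_mul, map_add]
  exact add_mem (key 0 _ rfl) (key 1 _ rfl)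

theorem RegularSymbol.dirDeriv_pow {z₀ : ℂ} {e : ℤ} {G : MvPolynomial (Fin 2) RatFun2}
    (hG : RegularSymbol hN z₀ e G) (ζ : Fin 2 → ℂ) (k : ℕ) :
    RegularSymbol hN z₀ (e + k) ((_root_.dirDeriv (fun i => ratC (ζ i)) ^ k) G) := by
  induction k with
  | zero => simpa using hG
  | succ k ih =>
    rw [pow_succ', Module.End.mul_apply]
    push_cast
    rw [← add_assoc]
    exact ih.dirDeriv ζ

variable (hN)

/-- The action on functions homogeneous of degree `n` of the component of degree `-i` of
`[…[P, ℓ], …, ℓ] / (m - i)!`, with `m - i` commutators, where `ℓ = ⟨ζ, x⟩`. -/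
def opPiece (ζ : Fin 2 → ℂ) (P : MvPolynomial (Fin 2) RatFun2) (i : ℕ) (n : ℤ) :
    RatFunc ℂ →ₗ[ℂ] RatFunc ℂ :=
  if i ≤ P.totalDegree then
    ((P.totalDegree - i).factorial : ℂ)⁻¹ • homComp hN (n - i) ∘ₗ
      diffOp ((dirDeriv (fun j => ratC (ζ j)) ^ (P.totalDegree - i)) P) ∘ₗ homLift hN n
  else 0

variable {hN}

theorem opPiece_of_le {ζ : Fin 2 → ℂ} {P : MvPolynomial (Fin 2) RatFun2} {i : ℕ}
    (h : i ≤ P.totalDegree) (n : ℤ) (F : RatFunc ℂ) : opPiece hN ζ P i n F =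
    ((P.totalDegree - i).factorial : ℂ)⁻¹ • homComp hN (n - i)
      (diffOp ((dirDeriv (fun j => ratC (ζ j)) ^ (P.totalDegree - i)) P) (homLift hN n F)) := by
  rw [opPiece, if_pos h]; rfl

theorem opPiece_of_lt {ζ : Fin 2 → ℂ} {P : MvPolynomial (Fin 2) RatFun2} {i : ℕ}
    (h : P.totalDegree < i) (n : ℤ) : opPiece hN ζ P i n = 0 := by
  rw [opPiece, if_neg (by omega)]

theorem opPiece_mem {z₀ : ℂ} {P : MvPolynomial (Fin 2) RatFun2}
    (hP : RegularSymbol hN z₀ (-(P.totalDegree : ℤ)) P) (ζ : Fin 2 → ℂ) (i : ℕ) (n : ℤ)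
    {F : RatFunc ℂ} (hF : F ∈ regularAt z₀) : opPiece hN ζ P i n F ∈ regularAt z₀ := by
  rcases le_or_gt i P.totalDegree with h | h
  · rw [opPiece_of_le h]
    refine Subalgebra.smul_mem _ ?_ _
    have := (hP.dirDeriv_pow ζ (P.totalDegree - i)).diffOp_mem n hF
    rwa [show n + (-(P.totalDegree : ℤ) + (P.totalDegree - i : ℕ)) = n - i by omega] at this
  · rw [opPiece_of_lt h]
    exact zero_mem _

theorem eval_ratC_map (ζ : Fin 2 → ℂ) (p : MvPolynomial (Fin 2) ℂ) :
    eval (fun i => ratC (ζ i)) (map (algebraMap ℂ RatFun2) p) = ratC (eval ζ p) := by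
  rw [eval_map]
  exact (eval₂_comp ratC ζ p).symm

/-- With m the order, the m-fold commutator is multiplication by m! P₀(ζ), a constant because the
principal symbol does not depend on x. -/
theorem opPiece_zero {P : MvPolynomial (Fin 2) RatFun2} {P₀ : MvPolynomial (Fin 2) ℂ}
    (hconst : principalSymbol P = map (algebraMap ℂ RatFun2) P₀) (ζ : Fin 2 → ℂ) (n : ℤ)
    (F : RatFunc ℂ) : opPiece hN ζ P 0 n F = eval ζ P₀ • F := by
  rw [opPiece_of_le (Nat.zero_le _), Nat.sub_zero, dirDeriv_pow_eq_C le_rfl]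
  change _ • homComp hN _ (diffOp (C (_ * eval _ (principalSymbol P))) _) = _
  rw [hconst, eval_ratC_map, diffOp_C, ← map_natCast ratC, ← map_mul, mulOp_apply,
    ratC_mul_eq_smul, map_smul, Nat.cast_zero, sub_zero, homComp_homLift_self, smul_smul,
    inv_mul_cancel_left₀ (by exact_mod_cast Nat.factorial_ne_zero _)]

/-- The zero-order term `B` comes from the subprincipal coefficients and is unknown here; evaluation
on the constant 1 later shows that it vanishes. -/
theorem exists_opPiece_one {P : MvPolynomial (Fin 2) RatFun2} {P₀ : MvPolynomial (Fin 2) ℂ}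
    (hP : 0 < P.totalDegree)
    (hconst : principalSymbol P = map (algebraMap ℂ RatFun2) P₀) (ζ : Fin 2 → ℂ) :
    ∃ B : RatFunc ℂ, ∀ (n : ℤ) (F : RatFunc ℂ), opPiece hN ζ P 1 n F = B * F +
      ((a * eval ζ (pderiv 0 P₀) + b * eval ζ (pderiv 1 P₀)) • ratDeriv F +
        (-b * eval ζ (pderiv 0 P₀) + a * eval ζ (pderiv 1 P₀)) • sliceY n F) := by
  obtain ⟨k, hk⟩ := Nat.exists_eq_add_of_lt hP
  rw [zero_add] at hk
  have hk0 : (k.factorial : ℂ) ≠ 0 := by exact_mod_cast Nat.factorial_ne_zero _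
  have hh : homogeneousComponent (k + 1) P = map (algebraMap ℂ RatFun2) P₀ := by
    rw [← hconst, principalSymbol, hk]
  refine ⟨homComp hN (-1) (eval (fun i => ratC (ζ i)) (homogeneousComponent k P)), fun n F => ?_⟩
  rw [opPiece_of_le (by omega), hk, Nat.add_sub_cancel, dirDeriv_pow_eq_linear hk.le, hh,
    pderiv_map, pderiv_map, eval_ratC_map, eval_ratC_map, diffOp_add, diffOp_add, diffOp_C,
    diffOp_C_mul_X, diffOp_C_mul_X]
  simp only [LinearMap.add_apply, Module.End.mul_apply, mulOp_apply, partialOp_apply]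
  rw [ratPderiv_zero_eq hN, ratPderiv_one_eq hN, derivT_homLift, derivY_homLift, ← sliceY_apply,
    ← map_natCast ratC, mul_assoc, mul_assoc, mul_assoc]
  simp only [ratC_mul_eq_smul, map_add, map_smul]
  rw [Nat.cast_one, homComp_homLift_self, homComp_homLift_self, mul_comm (eval _ _),
    homComp_homLift_mul, show n - 1 - n = -1 by ring]
  simp only [Algebra.smul_def, map_add, map_mul, map_neg, map_inv₀]
  have : algebraMap ℂ (RatFunc ℂ) k.factorial ≠ 0 := (map_ne_zero _).mpr hk0
  field_simp
  ring

/-- The component of degree -i - 2 of `commutator_iterate`. Division by (m - i)!, with m the order,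
absorbs the factor k + 1 there. -/
theorem opPiece_commutator {z₀ : ℂ} {H : Finset (EuclideanSpace ℝ (Fin 2))}
    {c : EuclideanSpace ℝ (Fin 2) → ℂ} {P : MvPolynomial (Fin 2) RatFun2}
    (hcomm : schrodinger H c * diffOp P = diffOp P * schrodinger H c) {V : RatFunc ℂ}
    (hV : ratC (a ^ 2 + b ^ 2)⁻¹ * potential H c = homLift hN (-2) V) (i : ℕ) (n : ℤ)
    (F : RatFunc ℂ) :
    sliceOp V (n - i) (opPiece hN ![z₀ * a - b, z₀ * b + a] P i n F) -
      opPiece hN ![z₀ * a - b, z₀ * b + a] P i (n - 2) (sliceOp V n F) =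
    (2 : ℂ) • (sliceFlow z₀ (n - i - 1) (opPiece hN ![z₀ * a - b, z₀ * b + a] P (i + 1) n F) -
      opPiece hN ![z₀ * a - b, z₀ * b + a] P (i + 1) (n - 1) (sliceFlow z₀ n F)) := by
  set ζ : Fin 2 → ℂ := ![z₀ * a - b, z₀ * b + a] with hζ
  set Λ := scaledOp a b (homLift hN (-2) V) with hΛ
  let Q : ℕ → Module.End ℂ RatFun2 := fun k => diffOp ((dirDeriv (fun j => ratC (ζ j)) ^ k) P)
  have hQ : ∀ k, Q (k + 1) = Q k * mulOp (linFun ζ) - mulOp (linFun ζ) * Q k := by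
    intro k
    rw [diffOp_mul_linFun, ← Module.End.mul_apply, ← pow_succ']
  have h0 : Λ * Q 0 = Q 0 * Λ := by
    rw [schrodinger_eq hN, hV, smul_mul_assoc, mul_smul_comm] at hcomm
    exact smul_right_injective _ hN hcomm
  have hΛh := isHomOp_scaledOp hN V
  have hDh := isHomOp_flowOp hN z₀
  rcases lt_trichotomy i P.totalDegree with hi | hi | hi
  · obtain ⟨k, hk⟩ := Nat.exists_eq_add_of_lt hi
    have e1 : P.totalDegree - i = k + 1 := by omega
    have e2 : P.totalDegree - (i + 1) = k := by omega
    rw [opPiece_of_le (by omega), opPiece_of_le (by omega), opPiece_of_le (by omega),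
      opPiece_of_le (by omega), e1, e2]
    have hc := commutator_iterate (scaledOp_commutator hN (homLift hN (-2) V) z₀)
      (flowOp_commutator hN z₀) (Q := Q) (fun n => by simp) hQ h0 k
    have hc' := congrArg (fun T : Module.End ℂ RatFun2 =>
      homComp hN (n - i + -2) (T (homLift hN n F))) hc
    have e3 : (2 * ((k : Module.End ℂ RatFun2) + 1)) = ((2 * (k + 1) : ℂ)) • 1 := by
      rw [← Algebra.algebraMap_eq_smul_one, map_mul, map_add, map_natCast, map_one, map_ofNat]
    simp only [e3, LinearMap.sub_apply, Module.End.mul_apply, LinearMap.smul_apply,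
      Module.End.one_apply, map_sub, map_smul] at hc'
    rw [hΛh.comp, hΛh.lift, hDh.lift, show n - i + -2 = n - i - 1 + -1 by ring, hDh.comp,
      ← smul_sub] at hc'
    rw [map_smul, map_smul, ← smul_sub, ← smul_sub, smul_smul,
      show n - 2 - (i : ℤ) = n - i - 1 + -1 by ring, show n - 2 = n + -2 by ring, hc', smul_smul,
      show n - 1 = n + -1 by ring]
    push_cast [Nat.factorial_succ]
    rw [show n - ((i : ℤ) + 1) = n - i - 1 by ring,
      show n + -1 - ((i : ℤ) + 1) = n - i - 1 + -1 by ring]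
    congr 1
    have : (k.factorial : ℂ) ≠ 0 := by exact_mod_cast Nat.factorial_ne_zero _
    have : (k : ℂ) + 1 ≠ 0 := by exact_mod_cast Nat.succ_ne_zero k
    field_simp
  -- At i equal to the order of P no commutator with ℓ is taken: the identity is a graded piece of
  -- [L, P] = 0.
  · rw [opPiece_of_lt (i := i + 1) (by omega), opPiece_of_lt (i := i + 1) (by omega),
      opPiece_of_le (by omega), opPiece_of_le (by omega), map_smul,
      show n - 2 - (i : ℤ) = n - i + -2 by ring, show n - 2 = n + -2 by ring,
      ← hΛh.lift, ← hΛh.comp, ← smul_sub, ← map_sub, ← hi, Nat.sub_self]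
    have := congrArg (fun T : Module.End ℂ RatFun2 => T (homLift hN n F)) h0
    simp only [Module.End.mul_apply] at this
    change _ • homComp hN _ (Λ (Q 0 _) - Q 0 (Λ _)) = _
    rw [this]
    simp
  · rw [opPiece_of_lt (by omega), opPiece_of_lt (by omega), opPiece_of_lt (by omega),
      opPiece_of_lt (by omega)]
    simp

/-- The symbol of a commuting operator gives a formal eigenfunction, regular at `z₀`, of the
Schrödinger operator. -/
theorem exists_slice_eigenfunction {z₀ : ℂ} {H : Finset (EuclideanSpace ℝ (Fin 2))}
    {c : EuclideanSpace ℝ (Fin 2) → ℂ} {P : MvPolynomial (Fin 2) RatFun2}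
    (hcomm : schrodinger H c * diffOp P = diffOp P * schrodinger H c) {V : RatFunc ℂ}
    (hV : ratC (a ^ 2 + b ^ 2)⁻¹ * potential H c = homLift hN (-2) V) (hVr : V ∈ regularAt z₀)
    (hP : RegularSymbol hN z₀ (-(P.totalDegree : ℤ)) P) (hdeg : 0 < P.totalDegree)
    {P₀ : MvPolynomial (Fin 2) ℂ} (hconst : principalSymbol P = map (algebraMap ℂ RatFun2) P₀)
    (hrot : eval ![z₀ * a - b, z₀ * b + a] (X 1 * pderiv 0 P₀ - X 0 * pderiv 1 P₀) ≠ 0) (j : ℕ) :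
    ∃ F : ℕ → RatFunc ℂ, F 0 = 1 ∧ ∀ i < j,
      (2 : ℂ) • sliceFlow z₀ (-((i + 1 : ℕ) : ℤ)) (F (i + 1)) = sliceOp V (-(i : ℤ)) (F i) := by
  obtain ⟨B, hB⟩ := exists_opPiece_one (hN := hN) hdeg hconst ![z₀ * a - b, z₀ * b + a]
  have hsolve : opPiece hN ![z₀ * a - b, z₀ * b + a] P 1 0 1 = 0 → ∀ n : ℤ, n ≤ -2 →
      ∀ F ∈ regularAt z₀, ∀ G ∈ regularAt z₀,
      opPiece hN ![z₀ * a - b, z₀ * b + a] P 1 n F = sliceFlow z₀ n G →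
      ∃ F' ∈ regularAt z₀, sliceFlow z₀ (n + 1) F' = F := by
    intro h1 n hn F hF G hG h
    rw [hB] at h1 h
    have hB0 : B = 0 := by simpa [sliceY_apply] using h1
    rw [hB0, zero_mul, zero_add] at h
    refine exists_sliceFlow_eq ?_ (by omega) hF hG h
    -- If ∇P₀(ζ) were parallel to ζ, the rotation field would annihilate P₀ at ζ.
    intro h2
    apply hrot
    simp only [map_sub, map_mul, eval_X, Matrix.cons_val_zero, Matrix.cons_val_one]
    linear_combination h2
  obtain ⟨F, h0, _, hF⟩ := exists_formal_eigenfunction (Subalgebra.toSubmodule (regularAt z₀)) 1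
    (one_mem (regularAt z₀)) (sliceFlow z₀) (sliceOp V)
    (opPiece hN ![z₀ * a - b, z₀ * b + a] P) _ (opPiece_zero hconst _)
    (opPiece_commutator hcomm hV) (fun n hn F hF => eq_zero_of_sliceFlow_eq_zero hn hF)
    (fun i n F hF => opPiece_mem hP _ i n hF) (fun n F hF => sliceOp_mem_regularAt hVr hF n)
    (by simp [sliceFlow_eq]) hsolve j
  exact ⟨F, h0, hF⟩

end coordinates

/-! ### Laurent expansions at z = 0 -/

/-- The Laurent expansion at `z = 0` of a polynomial. -/
def polyLaurent : Polynomial ℂ →+* LaurentSeries ℂ :=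
  (HahnSeries.ofPowerSeries ℤ ℂ).comp Polynomial.coeToPowerSeries.ringHom

theorem polyLaurent_isUnit (s : nonZeroDivisors (Polynomial ℂ)) : IsUnit (polyLaurent s) := by
  refine IsUnit.mk0 (G₀ := LaurentSeries ℂ) _ ?_
  have hinj : Function.Injective polyLaurent :=
    (HahnSeries.ofPowerSeries_injective (Γ := ℤ) (R := ℂ)).comp (Polynomial.coe_injective ℂ)
  exact (map_ne_zero_iff _ hinj).mpr (nonZeroDivisors.ne_zero s.2)

/-- The Laurent expansion at `z = 0` of a rational function. -/
def ratLaurent : RatFunc ℂ →+* LaurentSeries ℂ :=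
  IsLocalization.lift (M := nonZeroDivisors (Polynomial ℂ)) polyLaurent_isUnit

theorem ratLaurent_poly (p : Polynomial ℂ) : ratLaurent (algebraMap _ (RatFunc ℂ) p) =
    HahnSeries.ofPowerSeries ℤ ℂ (p : PowerSeries ℂ) :=
  IsLocalization.lift_eq _ _

theorem ratLaurent_X : ratLaurent RatFunc.X = HahnSeries.single 1 1 := by
  rw [← RatFunc.algebraMap_X, ratLaurent_poly, Polynomial.coe_X, PowerSeries.coe_X]

theorem ratLaurent_const (c : ℂ) :
    ratLaurent (algebraMap ℂ (RatFunc ℂ) c) = HahnSeries.C c := by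
  have : algebraMap ℂ (RatFunc ℂ) c = algebraMap _ (RatFunc ℂ) (Polynomial.C c) := rfl
  rw [this, ratLaurent_poly, Polynomial.coe_C, PowerSeries.coe_C]

theorem ratLaurent_const_mul_coeff (c : ℂ) (F : RatFunc ℂ) (n : ℤ) :
    (ratLaurent (algebraMap ℂ (RatFunc ℂ) c * F)).coeff n = c * (ratLaurent F).coeff n := by
  rw [map_mul, ratLaurent_const, HahnSeries.C_mul_eq_smul, HahnSeries.coeff_smul, smul_eq_mul]

theorem ratLaurent_smul_coeff (c : ℂ) (F : RatFunc ℂ) (n : ℤ) :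
    (ratLaurent (c • F)).coeff n = c * (ratLaurent F).coeff n := by
  rw [Algebra.smul_def, ratLaurent_const_mul_coeff]

theorem ratLaurent_X_mul_coeff (F : RatFunc ℂ) (n : ℤ) :
    (ratLaurent (RatFunc.X * F)).coeff n = (ratLaurent F).coeff (n - 1) := by
  rw [map_mul, ratLaurent_X, HahnSeries.coeff_single_mul, one_mul]

theorem ratLaurent_X_pow_mul_coeff (k : ℕ) (F : RatFunc ℂ) (n : ℤ) :
    (ratLaurent (RatFunc.X ^ k * F)).coeff n = (ratLaurent F).coeff (n - k) := by
  induction k generalizing n with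
  | zero => simp
  | succ k ih =>
    rw [pow_succ', mul_assoc, ratLaurent_X_mul_coeff, ih]
    push_cast
    rw [sub_sub, add_comm]

theorem ratLaurent_X_inv_sq_mul_coeff (F : RatFunc ℂ) (n : ℤ) :
    (ratLaurent ((RatFunc.X ^ 2)⁻¹ * F)).coeff n = (ratLaurent F).coeff (n + 2) := by
  have h := ratLaurent_X_pow_mul_coeff 2 ((RatFunc.X ^ 2)⁻¹ * F) (n + 2)
  rw [mul_inv_cancel_left₀ (pow_ne_zero 2 RatFunc.X_ne_zero)] at h
  rw [h]
  norm_num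

theorem ratLaurent_X_mul_ratDeriv (F : RatFunc ℂ) :
    ratLaurent (RatFunc.X * ratDeriv F) = gradedDerivation 0 1 (ratLaurent F) := by
  refine eq_of_leibniz_ratFunc (E := LaurentSeries ℂ) ratLaurent
    (fun F => ratLaurent (RatFunc.X * ratDeriv F))
    (fun F => gradedDerivation 0 1 (ratLaurent F))
    (fun f g => by rw [map_add ratDeriv, mul_add, map_add])
    (fun f g => by rw [map_add, map_add]) ?_ ?_ ?_ ?_ F
  · intro x y
    rw [← map_mul, ← map_mul, ← map_add]
    congr 1
    rw [Derivation.leibniz, smul_eq_mul, smul_eq_mul]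
    ring
  · intro x y
    rw [map_mul, gradedDerivation_leibniz]
  · intro c
    rw [ratDeriv_algebraMap, mul_zero, map_zero, ratLaurent_const, HahnSeries.C_apply,
      gradedDerivation_single]
    simp
  · rw [ratDeriv_X, mul_one, ratLaurent_X, gradedDerivation_single]
    simp

theorem ratLaurent_ratDeriv_coeff (F : RatFunc ℂ) (n : ℤ) :
    (ratLaurent (ratDeriv F)).coeff n = (n + 1) * (ratLaurent F).coeff (n + 1) := by
  have h := congrArg (fun g : LaurentSeries ℂ => g.coeff (n + 1)) (ratLaurent_X_mul_ratDeriv F)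
  simp only [ratLaurent_X_mul_coeff, gradedDerivation_coeff] at h
  rw [add_sub_cancel_right] at h
  simpa using h

theorem LaurentSeries.coeff_mul_eq_zero {g h : LaurentSeries ℂ} {r s : ℤ}
    (hg : ∀ n < r, g.coeff n = 0) (hh : ∀ n < s, h.coeff n = 0) {n : ℤ} (hn : n < r + s) :
    (g * h).coeff n = 0 := by
  rw [HahnSeries.coeff_mul]
  refine Finset.sum_eq_zero fun ij hij => ?_
  have hij' : ij.1 + ij.2 = n := (Finset.mem_antidiagonal.mp hij).2.2
  rcases lt_or_ge ij.1 r with h1 | h1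
  · rw [hg _ h1, zero_mul]
  · rw [hh _ (by omega), mul_zero]

theorem ratLaurent_coeff_of_neg {U : RatFunc ℂ} (hU : U ∈ regularAt 0) {n : ℤ} (hn : n < 0) :
    (ratLaurent U).coeff n = 0 := by
  obtain ⟨p, q, hq, h⟩ := hU
  have hq0 : PowerSeries.constantCoeff (q : PowerSeries ℂ) ≠ 0 := by
    rwa [Polynomial.constantCoeff_coe, Polynomial.coeff_zero_eq_eval_zero]
  have e : ratLaurent U =
      HahnSeries.ofPowerSeries ℤ ℂ ((p : PowerSeries ℂ) * (q : PowerSeries ℂ)⁻¹) := by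
    have h' := congrArg ratLaurent h
    rw [map_mul, ratLaurent_poly, ratLaurent_poly] at h'
    rw [map_mul, ← h', mul_assoc, ← map_mul, PowerSeries.mul_inv_cancel _ hq0, map_one, mul_one]
  rw [e, PowerSeries.coeff_coe, if_pos hn]

/-- The Laurent expansion of a potential with a double pole at `0`. -/
def PotentialExpansion (V : RatFunc ℂ) (k S0 S1 S2 S3 : ℂ) : Prop :=
  ∃ U ∈ regularAt 0, V = algebraMap ℂ (RatFunc ℂ) k * (RatFunc.X ^ 2)⁻¹ +
    algebraMap ℂ (RatFunc ℂ) S0 + algebraMap ℂ (RatFunc ℂ) (-2 * S1) * RatFunc.X ^ 1 +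
    algebraMap ℂ (RatFunc ℂ) (3 * S2) * RatFunc.X ^ 2 +
    algebraMap ℂ (RatFunc ℂ) (-4 * S3) * RatFunc.X ^ 3 + RatFunc.X ^ 4 * U

theorem PotentialExpansion.coeff_mul {V : RatFunc ℂ} {k S0 S1 S2 S3 : ℂ}
    (hV : PotentialExpansion V k S0 S1 S2 S3) {F : RatFunc ℂ} {i : ℕ}
    (hF : ∀ n : ℤ, n < -i → (ratLaurent F).coeff n = 0) {n : ℤ} (hn : n ≤ 3 - i) :
    (ratLaurent (V * F)).coeff n = k * (ratLaurent F).coeff (n + 2) +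
      S0 * (ratLaurent F).coeff n + -2 * S1 * (ratLaurent F).coeff (n - 1) +
      3 * S2 * (ratLaurent F).coeff (n - 2) + -4 * S3 * (ratLaurent F).coeff (n - 3) := by
  obtain ⟨U, hU, rfl⟩ := hV
  -- The remainder z⁴ U contributes only coefficients of `F` at indices at most n - 4 < -i, which
  -- vanish; hence the bound n ≤ 3 - i.
  have hUF : (ratLaurent (U * F)).coeff (n - 4) = 0 := by
    rw [map_mul]
    exact LaurentSeries.coeff_mul_eq_zero (r := 0) (s := -i)
      (fun n hn => ratLaurent_coeff_of_neg hU hn) hF (by omega)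
  simp only [add_mul, map_add ratLaurent, HahnSeries.coeff_add]
  rw [mul_assoc, mul_assoc, mul_assoc, mul_assoc, mul_assoc]
  simp only [ratLaurent_const_mul_coeff, ratLaurent_X_pow_mul_coeff,
    ratLaurent_X_inv_sq_mul_coeff]
  push_cast
  rw [hUF, add_zero]

theorem ratLaurent_sliceFlow_coeff (z₀ : ℂ) (d : ℤ) (F : RatFunc ℂ) (n : ℤ) :
    (ratLaurent (sliceFlow z₀ d F)).coeff n =
      z₀ * ((n + 1) * (ratLaurent F).coeff (n + 1)) - (n - d) * (ratLaurent F).coeff n := by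
  rw [sliceFlow_apply, map_add, map_sub, HahnSeries.coeff_add, HahnSeries.coeff_sub,
    ratLaurent_smul_coeff, ratLaurent_smul_coeff, ratLaurent_X_mul_coeff,
    ratLaurent_ratDeriv_coeff, ratLaurent_ratDeriv_coeff, sub_add_cancel]
  push_cast
  ring

theorem ratLaurent_sliceY_coeff (d : ℤ) (F : RatFunc ℂ) (n : ℤ) :
    (ratLaurent (sliceY d F)).coeff n = (d - n) * (ratLaurent F).coeff n := by
  rw [sliceY_apply, map_sub, HahnSeries.coeff_sub, ratLaurent_smul_coeff, ratLaurent_X_mul_coeff,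
    ratLaurent_ratDeriv_coeff, sub_add_cancel]
  push_cast
  ring

theorem ratLaurent_sliceOp_coeff {V : RatFunc ℂ} (d : ℤ) (F : RatFunc ℂ) (n : ℤ) :
    (ratLaurent (sliceOp V d F)).coeff n =
      (ratLaurent (V * F)).coeff n - (n + 2) * (n + 1) * (ratLaurent F).coeff (n + 2) -
        (d - n) * (d - 1 - n) * (ratLaurent F).coeff n := by
  rw [sliceOp_apply, map_add, map_neg, map_add, HahnSeries.coeff_add, HahnSeries.coeff_neg,
    HahnSeries.coeff_add, ratLaurent_sliceY_coeff, ratLaurent_sliceY_coeff,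
    ratLaurent_ratDeriv_coeff, ratLaurent_ratDeriv_coeff, add_assoc n 1 1]
  push_cast
  norm_num
  ring

/-! ### Pole orders and obstructions for the formal eigenfunction -/

section eigenfunction

variable {z₀ : ℂ} {V : RatFunc ℂ} {k S0 S1 S2 S3 : ℂ} {F : ℕ → RatFunc ℂ}

theorem PotentialExpansion.recursion (hV : PotentialExpansion V k S0 S1 S2 S3) {i : ℕ}
    (hF : (2 : ℂ) • sliceFlow z₀ (-((i + 1 : ℕ) : ℤ)) (F (i + 1)) = sliceOp V (-(i : ℤ)) (F i))
    (hs : ∀ n : ℤ, n < -i → (ratLaurent (F i)).coeff n = 0) {n : ℤ} (hn : n ≤ 3 - i) :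
    2 * (z₀ * ((n + 1) * (ratLaurent (F (i + 1))).coeff (n + 1)) -
      (n + i + 1) * (ratLaurent (F (i + 1))).coeff n) =
    (k - (n + 2) * (n + 1)) * (ratLaurent (F i)).coeff (n + 2) -
      (n + i) * (n + i + 1) * (ratLaurent (F i)).coeff n + S0 * (ratLaurent (F i)).coeff n +
      -2 * S1 * (ratLaurent (F i)).coeff (n - 1) + 3 * S2 * (ratLaurent (F i)).coeff (n - 2) +
      -4 * S3 * (ratLaurent (F i)).coeff (n - 3) := by
  have h := congrArg (fun g : RatFunc ℂ => (ratLaurent g).coeff n) hF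
  simp only [ratLaurent_smul_coeff, ratLaurent_sliceFlow_coeff, ratLaurent_sliceOp_coeff,
    hV.coeff_mul hs hn] at h
  push_cast at h
  linear_combination h

/-- The Laurent coefficients of a formal eigenfunction: the component of degree `-i` has a pole of
order at most `i` at `z = 0`. -/
theorem PotentialExpansion.coeff_eq_zero (hV : PotentialExpansion V k S0 S1 S2 S3) (hz₀ : z₀ ≠ 0)
    (hF0 : F 0 = 1) {j : ℕ} (hF : ∀ i < j,
      (2 : ℂ) • sliceFlow z₀ (-((i + 1 : ℕ) : ℤ)) (F (i + 1)) = sliceOp V (-(i : ℤ)) (F i))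
    (i : ℕ) (hi : i ≤ j) : ∀ n : ℤ, n < -i → (ratLaurent (F i)).coeff n = 0 := by
  induction i with
  | zero =>
    intro n hn
    rw [hF0, map_one, HahnSeries.coeff_one, if_neg]
    rintro rfl
    simp at hn
  | succ i ih =>
    have hs := ih (by omega)
    -- Below -i - 2 the source term has no coefficients, and the factor n + 1 is nonzero, so a zero
    -- coefficient forces the next one to be zero.
    have hstep : ∀ n : ℤ, n < -i - 2 → (ratLaurent (F (i + 1))).coeff n = 0 →
        (ratLaurent (F (i + 1))).coeff (n + 1) = 0 := by
      intro n hn h0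
      have h := hV.recursion (hF i (by omega)) hs (n := n) (by omega)
      rw [h0, hs (n + 2) (by omega), hs n (by omega), hs (n - 1) (by omega),
        hs (n - 2) (by omega), hs (n - 3) (by omega)] at h
      have hn1 : (n : ℂ) + 1 ≠ 0 := by
        have : n + 1 ≠ 0 := by omega
        exact_mod_cast this
      simpa [hz₀, hn1] using h
    set o := (ratLaurent (F (i + 1))).order with ho
    -- The induction starts at o - 1, just below the order of the series, where the coefficient is
    -- zero.
    have hlow : ∀ r : ℕ, o - 1 + r ≤ -i - 2 → (ratLaurent (F (i + 1))).coeff (o - 1 + r) = 0 := by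
      intro r
      induction r with
      | zero => intro _; exact HahnSeries.coeff_eq_zero_of_lt_order (by simp [ho])
      | succ r ihr =>
        intro hr
        push_cast at hr ⊢
        rw [← add_assoc]
        exact hstep _ (by omega) (ihr (by omega))
    intro n hn
    push_cast at hn
    rcases lt_or_ge n o with h | h
    · exact HahnSeries.coeff_eq_zero_of_lt_order h
    · have := hlow (n - o + 1).toNat (by omega)
      rwa [show o - 1 + ((n - o + 1).toNat : ℤ) = n by omega] at this

theorem PotentialExpansion.laurentRecursion (hV : PotentialExpansion V k S0 S1 S2 S3)
    (hz₀ : z₀ ≠ 0) (hF0 : F 0 = 1) (hF : ∀ i < 5,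
      (2 : ℂ) • sliceFlow z₀ (-((i + 1 : ℕ) : ℤ)) (F (i + 1)) = sliceOp V (-(i : ℤ)) (F i)) :
    LaurentRecursion (fun i n => (ratLaurent (F i)).coeff n) k z₀⁻¹ S0 S1 S2 S3 := by
  rintro i n ⟨hi, hn⟩
  have h := hV.recursion (hF i hi) (hV.coeff_eq_zero hz₀ hF0 hF i hi.le) hn
  simp only
  rw [← h]
  field_simp

theorem PotentialExpansion.obstruction (hV : PotentialExpansion V k S0 S1 S2 S3)
    (hk : k ≠ 0) (hz₀ : z₀ ≠ 0) (hF0 : F 0 = 1) (hF : ∀ i < 5,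
      (2 : ℂ) • sliceFlow z₀ (-((i + 1 : ℕ) : ℤ)) (F (i + 1)) = sliceOp V (-(i : ℤ)) (F i)) :
    S1 = 0 ∧ (k - 2) * S3 = 0 := by
  have hr := hV.laurentRecursion hz₀ hF0 hF
  have h00 : (ratLaurent (F 0)).coeff 0 = 1 := by rw [hF0, map_one]; simp
  have h0 : ∀ n : ℤ, n ≠ 0 → (ratLaurent (F 0)).coeff n = 0 := by
    intro n hn
    rw [hF0, map_one, HahnSeries.coeff_one, if_neg hn]
  have hs : ∀ (i : ℕ) (n : ℤ), i ≤ 5 ∧ n < -i → (ratLaurent (F i)).coeff n = 0 :=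
    fun i n h => hV.coeff_eq_zero hz₀ hF0 hF i h.1 n h.2
  have hS1 : S1 = 0 := by
    have := LaurentRecursion.first_obstruction h00 h0 hs hr
    simpa [hk, hz₀] using this
  refine ⟨hS1, ?_⟩
  have := LaurentRecursion.second_obstruction h00 h0 hs hr hS1
  simpa [hk, hz₀] using this

end eigenfunction

/-! ### Expansion of the inverse-square potential -/

/-- The slice of the potential `s ⟨β, x⟩⁻²`, up to scaling. -/
def slicePole (s A B : ℂ) : RatFunc ℂ :=
  algebraMap ℂ (RatFunc ℂ) s *
    (algebraMap (Polynomial ℂ) (RatFunc ℂ) (Polynomial.C A * Polynomial.X + Polynomial.C B))⁻¹ ^ 2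

theorem algebraMap_linear (A B : ℂ) :
    algebraMap (Polynomial ℂ) (RatFunc ℂ) (Polynomial.C A * Polynomial.X + Polynomial.C B) =
      algebraMap ℂ (RatFunc ℂ) A * RatFunc.X + algebraMap ℂ (RatFunc ℂ) B := by
  rw [map_add, map_mul, RatFunc.algebraMap_X]
  rfl

theorem slicePole_mem_regularAt (s : ℂ) {A B z₀ : ℂ}
    (h : (Polynomial.C A * Polynomial.X + Polynomial.C B).eval z₀ ≠ 0) :
    slicePole s A B ∈ regularAt z₀ :=
  mul_mem (Subalgebra.algebraMap_mem _ _) (pow_mem (inv_mem_regularAt h) 2)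

theorem PotentialExpansion.add {V W : RatFunc ℂ} {k S0 S1 S2 S3 k' T0 T1 T2 T3 : ℂ}
    (hV : PotentialExpansion V k S0 S1 S2 S3) (hW : PotentialExpansion W k' T0 T1 T2 T3) :
    PotentialExpansion (V + W) (k + k') (S0 + T0) (S1 + T1) (S2 + T2) (S3 + T3) := by
  obtain ⟨U, hU, rfl⟩ := hV
  obtain ⟨U', hU', rfl⟩ := hW
  refine ⟨U + U', add_mem hU hU', ?_⟩
  simp only [map_add, map_mul]
  ring

theorem PotentialExpansion.sum {ι : Type*} (s : Finset ι) {V : ι → RatFunc ℂ}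
    {S0 S1 S2 S3 : ι → ℂ}
    (h : ∀ i ∈ s, PotentialExpansion (V i) 0 (S0 i) (S1 i) (S2 i) (S3 i)) :
    PotentialExpansion (∑ i ∈ s, V i) 0 (∑ i ∈ s, S0 i) (∑ i ∈ s, S1 i) (∑ i ∈ s, S2 i)
      (∑ i ∈ s, S3 i) := by
  classical
  induction s using Finset.induction_on with
  | empty => exact ⟨0, zero_mem _, by simp⟩
  | insert i s hi ih =>
    simp only [Finset.sum_insert hi]
    have := (h i (Finset.mem_insert_self i s)).add
      (ih fun j hj => h j (Finset.mem_insert_of_mem hj))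
    rwa [add_zero] at this

theorem potentialExpansion_slicePole_zero (s A : ℂ) :
    PotentialExpansion (slicePole s A 0) (s / A ^ 2) 0 0 0 0 := by
  refine ⟨0, zero_mem _, ?_⟩
  rw [slicePole, algebraMap_linear]
  simp only [map_zero, mul_zero, add_zero, zero_mul, map_div₀, map_pow]
  rw [inv_pow, mul_pow, mul_inv, div_eq_mul_inv]
  ring

theorem potentialExpansion_slicePole (s A : ℂ) {B : ℂ} (hB : B ≠ 0) :
    PotentialExpansion (slicePole s A B) 0 (s / B ^ 2) (s * A / B ^ 3) (s * A ^ 2 / B ^ 4)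
      (s * A ^ 3 / B ^ 5) := by
  have hB' : (Polynomial.C A * Polynomial.X + Polynomial.C B).eval 0 ≠ 0 := by simpa using hB
  have h0 : algebraMap (Polynomial ℂ) (RatFunc ℂ) (Polynomial.C A * Polynomial.X + Polynomial.C B)
      ≠ 0 := by
    refine (map_ne_zero_iff _ (RatFunc.algebraMap_injective ℂ)).mpr fun h => ?_
    rw [h] at hB'
    simp at hB'
  -- With w = A z / B this is the exact remainder (1 + w)⁻² = 1 - 2w + 3w² - 4w³ + w⁴ (5 + 4w) (1 +
  -- w)⁻².
  refine ⟨algebraMap (Polynomial ℂ) (RatFunc ℂ) (Polynomial.C (5 * s * A ^ 4 / B ^ 4) +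
    Polynomial.C (4 * s * A ^ 5 / B ^ 5) * Polynomial.X) *
    (algebraMap (Polynomial ℂ) (RatFunc ℂ) (Polynomial.C A * Polynomial.X + Polynomial.C B))⁻¹ ^ 2,
    mul_mem (algebraMap_mem_regularAt _ _) (pow_mem (inv_mem_regularAt hB') 2), ?_⟩
  rw [add_comm (Polynomial.C (5 * s * A ^ 4 / B ^ 4)), slicePole, algebraMap_linear (_ / _)]
  rw [algebraMap_linear] at h0 ⊢
  have hB0 : algebraMap ℂ (RatFunc ℂ) B ≠ 0 := (map_ne_zero _).mpr hB
  simp only [map_zero, zero_mul, zero_add, map_mul, map_div₀, map_pow, map_neg, map_ofNat]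
  field_simp
  ring

section coordinates

variable {a b : ℂ} (hN : a ^ 2 + b ^ 2 ≠ 0)

theorem linForm_eq (β : EuclideanSpace ℝ (Fin 2)) :
    linForm β = ratC (a ^ 2 + b ^ 2)⁻¹ *
      (ratSlice hN (algebraMap (Polynomial ℂ) (RatFunc ℂ)
        (Polynomial.C (a * β 0 + b * β 1) * Polynomial.X + Polynomial.C (-b * β 0 + a * β 1))) *
        coordY a b) := by
  have hY := coordY_ne_zero hN
  have hNr : ratC a ^ 2 + ratC b ^ 2 ≠ 0 := by
    rw [← map_pow, ← map_pow, ← map_add]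
    exact (map_ne_zero ratC).mpr hN
  have h1 : linForm β = ratC (β 0 : ℂ) * ratX 0 + ratC (β 1 : ℂ) * ratX 1 := by
    rw [linForm, Fin.sum_univ_two, map_add, map_mul, map_mul]
    rfl
  rw [h1, algebraMap_linear, map_add, map_mul, ratSlice_const, ratSlice_const, ratSlice_X, add_mul,
    mul_assoc, div_mul_cancel₀ _ hY, coordT, coordY]
  simp only [map_add, map_mul, map_neg, map_inv₀, map_pow]
  field_simp
  ring

/-- In adapted coordinates ⟨β, x⟩ = (A t + B y) / (a² + b²). The square contributes (a² + b²)², and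
the rescaling of the operator removes one factor. -/
theorem homLift_slicePole (γ : ℂ) (β : EuclideanSpace ℝ (Fin 2)) :
    homLift hN (-2) (slicePole (γ * (a ^ 2 + b ^ 2)) (a * β 0 + b * β 1) (-b * β 0 + a * β 1)) =
      ratC (a ^ 2 + b ^ 2)⁻¹ * (algebraMap ℂ RatFun2 γ / linForm β ^ 2) := by
  have hNr : ratC (a ^ 2 + b ^ 2) ≠ 0 := (map_ne_zero ratC).mpr hN
  rw [linForm_eq hN, homLift_apply, slicePole, map_mul, map_pow, map_inv₀, ratSlice_const, map_mul,
    map_inv₀, zpow_neg, div_eq_mul_inv, mul_pow, mul_pow, mul_inv, mul_inv, inv_pow, inv_pow,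
    inv_inv]
  change ratC γ * _ * _ * (coordY a b ^ (2 : ℕ))⁻¹ = _ * (ratC γ * _)
  field_simp

end coordinates

/-! ### Choice of the direction and the obstruction for a line -/

theorem Polynomial.exists_eval_ne_zero {p : Polynomial ℂ} (hp : p ≠ 0) : ∃ z, p.eval z ≠ 0 := by
  by_contra! h
  exact hp (Polynomial.funext fun z => by simp [h z])

theorem eval_eq_restrictLine {a b : ℂ} (hN : a ^ 2 + b ^ 2 ≠ 0) {p : MvPolynomial (Fin 2) ℂ} {n : ℕ}
    (hp : p.IsHomogeneous n) (z : ℂ) :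
    eval ![z * a - b, z * b + a] p = (a ^ 2 + b ^ 2) ^ n * (restrictLine a b p).eval z := by
  have h1 : ![z * a - b, z * b + a] = fun i => (a ^ 2 + b ^ 2) * (lineParam a b i).eval z := by
    funext i
    fin_cases i <;> simp [lineParam] <;> field_simp
  have h2 : (restrictLine a b p).eval z = eval (fun i => (lineParam a b i).eval z) p := by
    have : (Polynomial.evalRingHom z).comp (restrictLine a b : _ →+* Polynomial ℂ) =
        eval fun i => (lineParam a b i).eval z := by
      apply MvPolynomial.ringHom_ext
      · intro c; simp [restrictLine]
      · intro i; simp [restrictLine]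
    exact congrArg (fun φ : MvPolynomial (Fin 2) ℂ →+* ℂ => φ p) this
  rw [h1, h2]
  exact hp.eval₂_mul (RingHom.id ℂ) _ _

/-- Sums over a configuration of lines containing `α₀` and the lines `H'`, in terms of the
coordinates of the lines with respect to `α₀ = (a, b)`. -/
theorem obstruction_of_commute {H H' : Finset (EuclideanSpace ℝ (Fin 2))}
    {c : EuclideanSpace ℝ (Fin 2) → ℂ} {α₀ : EuclideanSpace ℝ (Fin 2)} (hα₀ : α₀ ∉ H')
    (hH : H = Finset.cons α₀ H' hα₀) (hc : c α₀ ≠ 0) {a b : ℂ} (ha : (α₀ 0 : ℂ) = a)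
    (hb : (α₀ 1 : ℂ) = b) (hN : a ^ 2 + b ^ 2 ≠ 0) (hB : ∀ β ∈ H', -b * β 0 + a * β 1 ≠ 0)
    {P : MvPolynomial (Fin 2) RatFun2}
    (hcomm : schrodinger H c * diffOp P = diffOp P * schrodinger H c)
    {P₀ : MvPolynomial (Fin 2) ℂ}
    (hconst : principalSymbol P = MvPolynomial.map (algebraMap ℂ RatFun2) P₀)
    (hnontriv : P₀ ∉ Algebra.adjoin ℂ {(X 0 ^ 2 + X 1 ^ 2 : MvPolynomial (Fin 2) ℂ)}) :
    ∑ β ∈ H', c β * (a ^ 2 + b ^ 2) * (a * β 0 + b * β 1) / (-b * β 0 + a * β 1) ^ 3 = 0 ∧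
    (c α₀ / (a ^ 2 + b ^ 2) - 2) *
      ∑ β ∈ H', c β * (a ^ 2 + b ^ 2) * (a * β 0 + b * β 1) ^ 3 / (-b * β 0 + a * β 1) ^ 5 = 0 := by
  have hhom : P₀.IsHomogeneous P.totalDegree := by
    refine IsHomogeneous.of_map (algebraMap ℂ RatFun2).injective ?_
    rw [← hconst]
    exact homogeneousComponent_isHomogeneous _ _
  have hdeg : 0 < P.totalDegree := by
    refine Nat.pos_of_ne_zero fun h => hnontriv ?_
    rw [h] at hhom
    rw [totalDegree_eq_zero_iff_eq_C.mp (Nat.le_zero.mp hhom.totalDegree_le)]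
    exact Subalgebra.algebraMap_mem _ _
  set R : MvPolynomial (Fin 2) ℂ := X 1 * pderiv 0 P₀ - X 0 * pderiv 1 P₀ with hR
  have hRhom : R.IsHomogeneous P.totalDegree := by
    have h := fun i j : Fin 2 => (isHomogeneous_X ℂ i).mul (hhom.pderiv (i := j))
    rw [show 1 + (P.totalDegree - 1) = P.totalDegree by omega] at h
    exact (h 1 0).sub (h 0 1)
  -- Non-triviality of P enters here: the rotation field does not annihilate its principal symbol,
  -- so it fails to do so in all but finitely many directions.
  have hR0 : restrictLine a b R ≠ 0 := fun h =>
    hnontriv (mem_adjoin_of_rot_eq_zero hhom (restrictLine_eq_zero hN hRhom h))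
  choose q hq0 hq using fun p : Fin 2 →₀ ℕ => exists_forall_mem_regularAt
    (homComp hN ((p 0 : ℤ) + p 1 + -(P.totalDegree : ℤ)) (coeff p P))
  let lin : EuclideanSpace ℝ (Fin 2) → Polynomial ℂ := fun β =>
    Polynomial.C (a * β 0 + b * β 1) * Polynomial.X + Polynomial.C (-b * β 0 + a * β 1)
  have hlin : ∀ β ∈ H, lin β ≠ 0 := by
    intro β hβ h
    have e0 := congrArg (fun p => Polynomial.coeff p 0) h
    have e1 := congrArg (fun p => Polynomial.coeff p 1) h
    simp [lin] at e0 e1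
    rw [hH, Finset.mem_cons] at hβ
    rcases hβ with rfl | hβ
    · apply hN
      rw [ha, hb] at e1
      linear_combination e1
    · apply hB β hβ
      linear_combination e0
  -- Finitely many conditions on z₀: it is nonzero, the gradient is transversal there, and the
  -- relevant components of the coefficients of P and the potential are regular.
  obtain ⟨z₀, hz₀⟩ := Polynomial.exists_eval_ne_zero
    (p := Polynomial.X * restrictLine a b R * (∏ p ∈ P.support, q p) * ∏ β ∈ H, lin β)
    (mul_ne_zero (mul_ne_zero (mul_ne_zero Polynomial.X_ne_zero hR0)
      (Finset.prod_ne_zero_iff.mpr fun p _ => hq0 p)) (Finset.prod_ne_zero_iff.mpr hlin))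
  simp only [Polynomial.eval_mul, Polynomial.eval_X, Polynomial.eval_prod, mul_ne_zero_iff,
    Finset.prod_ne_zero_iff] at hz₀
  obtain ⟨⟨⟨hz, hzR⟩, hzq⟩, hzl⟩ := hz₀
  have hreg : RegularSymbol hN z₀ (-(P.totalDegree : ℤ)) P := by
    intro p
    by_cases hp : p ∈ P.support
    · exact hq p z₀ (hzq p hp)
    · rw [notMem_support_iff.mp hp, map_zero]
      exact zero_mem _
  let pole : EuclideanSpace ℝ (Fin 2) → RatFunc ℂ := fun β =>
    slicePole (c β * (a ^ 2 + b ^ 2)) (a * β 0 + b * β 1) (-b * β 0 + a * β 1)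
  have hV : ratC (a ^ 2 + b ^ 2)⁻¹ * potential H c = homLift hN (-2) (∑ β ∈ H, pole β) := by
    rw [potential, Finset.mul_sum, map_sum]
    exact Finset.sum_congr rfl fun β _ => (homLift_slicePole hN (c β) β).symm
  have hrot : eval ![z₀ * a - b, z₀ * b + a] R ≠ 0 := by
    rw [eval_eq_restrictLine hN hRhom]
    exact mul_ne_zero (pow_ne_zero _ hN) hzR
  obtain ⟨F, hF0, hF⟩ := exists_slice_eigenfunction hcomm hV
    (sum_mem fun β hβ => slicePole_mem_regularAt _ (hzl β hβ)) hreg hdeg hconst hrot 5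
  -- For β = α₀ one has B = 0 and A = a² + b², a pure double pole; every other line is regular at z
  -- = 0.
  have h1 : PotentialExpansion (pole α₀) (c α₀ / (a ^ 2 + b ^ 2)) 0 0 0 0 := by
    have h := potentialExpansion_slicePole_zero (c α₀ * (a ^ 2 + b ^ 2)) (a ^ 2 + b ^ 2)
    have e : c α₀ * (a ^ 2 + b ^ 2) / (a ^ 2 + b ^ 2) ^ 2 = c α₀ / (a ^ 2 + b ^ 2) := by
      field_simp
    rw [e] at h
    simp only [pole, ha, hb]
    rwa [show a * a + b * b = a ^ 2 + b ^ 2 by ring, show -b * a + a * b = 0 by ring]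
  have h2 := PotentialExpansion.sum H' fun β hβ => potentialExpansion_slicePole
    (c β * (a ^ 2 + b ^ 2)) (a * β 0 + b * β 1) (hB β hβ)
  have h3 := h1.add h2
  simp only [zero_add, add_zero] at h3
  have h4 : ∑ β ∈ H, pole β = pole α₀ + ∑ β ∈ H', pole β := by rw [hH, Finset.sum_cons]
  rw [h4] at hF
  exact h3.obstruction (div_ne_zero hc hN) hz hF0 hF

end

/-! ### Translation to inner products and norms -/

open Classical in
theorem theorem1p2
    (H : Finset (EuclideanSpace ℝ (Fin 2)))
    (hH0 : ∀ α ∈ H, α ≠ 0)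
    (hH : ∀ α ∈ H, ∀ β ∈ H, α ≠ β → LinearIndependent ℝ ![α, β])
    (c : EuclideanSpace ℝ (Fin 2) → ℂ)
    (hc : ∀ α ∈ H, c α ≠ 0)
    (P : MvPolynomial (Fin 2) RatFun2)
    (hcomm : schrodinger H c * diffOp P = diffOp P * schrodinger H c)
    (P₀ : MvPolynomial (Fin 2) ℂ)
    (hconst : principalSymbol P = MvPolynomial.map (algebraMap ℂ RatFun2) P₀)
    (hnontriv : P₀ ∉ Algebra.adjoin ℂ
      {(MvPolynomial.X 0 ^ 2 + MvPolynomial.X 1 ^ 2 : MvPolynomial (Fin 2) ℂ)})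
    (α₀ : EuclideanSpace ℝ (Fin 2)) (hα₀ : α₀ ∈ H) :
    (∑ β ∈ H with β ≠ α₀,
        ((inner ℝ α₀ β : ℝ) : ℂ) / ((inner ℝ (perp α₀) β : ℝ) : ℂ) ^ 3 * c β = 0) ∧
    ((c α₀ - 2 * (‖α₀‖ : ℂ) ^ 2) *
      ∑ β ∈ H with β ≠ α₀,
        ((inner ℝ α₀ β : ℝ) : ℂ) * (‖β‖ : ℂ) ^ 2 /
          ((inner ℝ (perp α₀) β : ℝ) : ℂ) ^ 5 * c β = 0) := by
  have hin : ∀ β : EuclideanSpace ℝ (Fin 2), ((inner ℝ α₀ β : ℝ) : ℂ) =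
      (α₀ 0 : ℂ) * β 0 + (α₀ 1 : ℂ) * β 1 := by
    intro β
    rw [PiLp.inner_apply, Fin.sum_univ_two]
    simp [mul_comm]
  have hpin : ∀ β : EuclideanSpace ℝ (Fin 2), ((inner ℝ (perp α₀) β : ℝ) : ℂ) =
      -(α₀ 1 : ℂ) * β 0 + (α₀ 0 : ℂ) * β 1 := by
    intro β
    rw [PiLp.inner_apply, Fin.sum_univ_two]
    simp [perp, mul_comm]
  have hnorm : ∀ β : EuclideanSpace ℝ (Fin 2), (‖β‖ : ℂ) ^ 2 = (β 0 : ℂ) ^ 2 + (β 1 : ℂ) ^ 2 := by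
    intro β
    have h := EuclideanSpace.real_norm_sq_eq β
    rw [Fin.sum_univ_two] at h
    exact_mod_cast h
  have hN : (α₀ 0 : ℂ) ^ 2 + (α₀ 1 : ℂ) ^ 2 ≠ 0 := by
    rw [← hnorm]
    exact pow_ne_zero 2 (by exact_mod_cast norm_ne_zero_iff.mpr (hH0 α₀ hα₀))
  have hB : ∀ β ∈ H.filter (· ≠ α₀), -(α₀ 1 : ℂ) * β 0 + (α₀ 0 : ℂ) * β 1 ≠ 0 := by
    intro β hβ h
    obtain ⟨hβH, hne⟩ := Finset.mem_filter.mp hβ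
    have hr : -α₀ 1 * β 0 + α₀ 0 * β 1 = 0 :=
      Complex.ofReal_injective (by push_cast; exact h)
    have hli := LinearIndependent.pair_iff.mp (hH α₀ hα₀ β hβH (Ne.symm hne))
    have h0 := (hli (β 0) (-α₀ 0) (by
      ext i
      fin_cases i <;> simp <;> linarith)).2
    have h1 := (hli (β 1) (-α₀ 1) (by
      ext i
      fin_cases i <;> simp <;> linarith)).2
    rw [neg_eq_zero] at h0 h1
    apply hN
    rw [h0, h1]
    simp
  have hcons : H = Finset.cons α₀ (H.filter (· ≠ α₀)) (by simp) := by
    ext β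
    by_cases h : β = α₀ <;> simp [h, hα₀]
  obtain ⟨h1, h3⟩ := obstruction_of_commute _ hcons (hc α₀ hα₀) rfl rfl hN hB hcomm hconst hnontriv
  have key1 : ∑ β ∈ H with β ≠ α₀,
      ((inner ℝ α₀ β : ℝ) : ℂ) / ((inner ℝ (perp α₀) β : ℝ) : ℂ) ^ 3 * c β = 0 := by
    refine (mul_eq_zero.mp ?_).resolve_left hN
    rw [← h1, Finset.mul_sum]
    refine Finset.sum_congr rfl fun β _ => ?_
    rw [hin, hpin]
    ring
  refine ⟨key1, ?_⟩
  -- Substituting |α₀|² |β|² = A² + B² splits A |β|² / B⁵ into the cubic sum and the sum already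
  -- known to vanish.
  have hsplit : (‖α₀‖ : ℂ) ^ 4 * ∑ β ∈ H with β ≠ α₀, ((inner ℝ α₀ β : ℝ) : ℂ) * (‖β‖ : ℂ) ^ 2 /
      ((inner ℝ (perp α₀) β : ℝ) : ℂ) ^ 5 * c β =
      ∑ β ∈ H with β ≠ α₀, c β * ((α₀ 0 : ℂ) ^ 2 + (α₀ 1 : ℂ) ^ 2) *
        ((α₀ 0 : ℂ) * β 0 + (α₀ 1 : ℂ) * β 1) ^ 3 / (-(α₀ 1 : ℂ) * β 0 + (α₀ 0 : ℂ) * β 1) ^ 5 +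
      (‖α₀‖ : ℂ) ^ 2 * ∑ β ∈ H with β ≠ α₀,
        ((inner ℝ α₀ β : ℝ) : ℂ) / ((inner ℝ (perp α₀) β : ℝ) : ℂ) ^ 3 * c β := by
    rw [Finset.mul_sum, Finset.mul_sum, ← Finset.sum_add_distrib]
    refine Finset.sum_congr rfl fun β hβ => ?_
    have := hB β hβ
    rw [hin, hpin, hnorm β, show (‖α₀‖ : ℂ) ^ 4 = ((‖α₀‖ : ℂ) ^ 2) ^ 2 by ring, hnorm α₀]
    field_simp
    ring
  rw [key1, mul_zero, add_zero] at hsplit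
  rw [← hsplit, ← hnorm α₀] at h3
  have hn0 : (‖α₀‖ : ℂ) ≠ 0 := by exact_mod_cast norm_ne_zero_iff.mpr (hH0 α₀ hα₀)
  refine (mul_eq_zero.mp ?_).resolve_left (pow_ne_zero 2 hn0)
  rw [← h3]
  field_simp
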